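/- Let $\gamma=(\gamma_1,\gamma_2,\gamma_3)\in\mathbb C^3$ satisfy $\mathrm{Im}\,\gamma_i<\tfrac12$ for $i=1,2,3$, $\mathrm{Im}(\gamma_1-\gamma_2)>-\tfrac12$ and $\mathrm{Im}(\gamma_2-\gamma_3)>-\tfrac12$ (for example $\gamma=(\lambda_1+\imath\varepsilon,\lambda_2-\imath\varepsilon,\lambda_3)$ with $\lambda\in\mathbb R^3$ and $0\le\varepsilon<\tfrac12$), and let $x=(x_1,x_2,x_3)\in\mathbb R^3$. Consider the modified Gauss–Givental integral for the $\mathfrak{gl}_3(\mathbb R)$-Whittaker function $$ \Psi^{GG}_{\gamma}(x)=\frac{e^{\imath(\gamma_1x_1+\gamma_2x_2+\gamma_3x_3)-x_1+x_3}}{(2\pi)^3}\int_{\mathbb R^3}ds_{11}\,ds_{21}\,ds_{22}\;e^{\imath s_{21}(x_1-x_2)+\imath s_{11}(x_1-x_3)+\imath s_{22}(x_2-x_3)}\, \Gamma\bigl(\tfrac12-\imath s_{21}\bigr)\Gamma\bigl(\tfrac12-\imath s_{11}\bigr)\Gamma\bigl(1-\imath s_{11}-\imath s_{22}\bigr) $$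 $$ \qquad\times\,\Gamma\bigl(1-\imath(\gamma_1-\gamma_3+s_{11}+s_{21})\bigr)\,\Gamma\bigl(\tfrac12-\imath(\gamma_2-\gamma_3+s_{22})\bigr)\,\Gamma\bigl(\tfrac12-\imath(\gamma_1-\gamma_2+s_{11})\bigr) $$ and the Mellin–Barnes integral $$ \Psi^{MB}_{\gamma}(x)=\frac{e^{\imath(\gamma_1+\gamma_2+\gamma_3)x_3-(x_1-x_3)}}{(2\pi)^3}\int_{\mathbb R^3}\frac{d\tau_{11}\,d\tau_{21}\,d\tau_{22}}{\Gamma(\imath\tau_{21}-\imath\tau_{22})\,\Gamma(\imath\tau_{22}-\imath\tau_{21})}\;e^{\imath(x_2-x_3)(\tau_{21}+\tau_{22})+\imath(x_1-x_2)\tau_{11}} $$ $$ \qquad\times\,\Gamma\bigl(\imath(\tau_{21}-\tau_{11})+\tfrac12\bigr)\,\Gamma\bigl(\imath(\tau_{22}-\tau_{11})+\tfrac12\bigr)\prod_{i=1}^3\prod_{j=1}^2\Gamma\bigl(\imath(\gamma_i-\tau_{2j})+\tfrac12\bigr). $$ Then both integrals converge absolutely, and $\Psi^{GG}_{\gamma}(x)=\frac1{2!}\,\Psi^{MB}_{\gamma}(x)$;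 that is, the two integrals coincide when the Mellin–Barnes integral is normalized by $\frac{1}{2!\,(2\pi)^3}$. -/

import Mathlib

open Complex MeasureTheory

noncomputable section

/-- The integrand of the modified Gauss-Givental integral for the `gl₃(ℝ)`-Whittaker function;
the integration variable is `s = (s₁₁, s₂₁, s₂₂)`, and `γ 0, γ 1, γ 2` (resp. `x 0, x 1, x 2`) are
`γ₁, γ₂, γ₃` (resp. `x₁, x₂, x₃`). -/
def gaussGiventalIntegrand (γ : Fin 3 → ℂ) (x : Fin 3 → ℝ) (s : ℝ × ℝ × ℝ) : ℂ :=
  let s₁₁ : ℂ := (s.1 : ℂ)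
  let s₂₁ : ℂ := (s.2.1 : ℂ)
  let s₂₂ : ℂ := (s.2.2 : ℂ)
  exp (I * s₂₁ * (x 0 - x 1) + I * s₁₁ * (x 0 - x 2) + I * s₂₂ * (x 1 - x 2))
    * Gamma (1 / 2 - I * s₂₁) * Gamma (1 / 2 - I * s₁₁) * Gamma (1 - I * s₁₁ - I * s₂₂)
    * Gamma (-I * (γ 0 - γ 2 + s₁₁ + s₂₁) + 1)
    * Gamma (-I * (γ 1 - γ 2 + s₂₂) + 1 / 2)
    * Gamma (-I * (γ 0 - γ 1 + s₁₁) + 1 / 2)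

/-- The modified Gauss-Givental integral for the `gl₃(ℝ)`-Whittaker function. -/
def gaussGiventalIntegral (γ : Fin 3 → ℂ) (x : Fin 3 → ℝ) : ℂ :=
  exp (I * (γ 0 * x 0 + γ 1 * x 1 + γ 2 * x 2) - x 0 + x 2) / (2 * Real.pi : ℂ) ^ 3
    * ∫ s : ℝ × ℝ × ℝ, gaussGiventalIntegrand γ x s

/-- The integrand of the Mellin-Barnes integral for the `gl₃(ℝ)`-Whittaker function;
the integration variable is `τ = (τ₁₁, τ₂₁, τ₂₂)`. On the null set `τ₂₁ = τ₂₂`, where both Gamma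
functions in the denominator have a pole, the quotient has the value `0`, which is also the value
of its continuous extension. -/
def mellinBarnesIntegrand (γ : Fin 3 → ℂ) (x : Fin 3 → ℝ) (τ : ℝ × ℝ × ℝ) : ℂ :=
  let τ₁₁ : ℂ := (τ.1 : ℂ)
  let τ₂₁ : ℂ := (τ.2.1 : ℂ)
  let τ₂₂ : ℂ := (τ.2.2 : ℂ)
  1 / (Gamma (I * τ₂₁ - I * τ₂₂) * Gamma (I * τ₂₂ - I * τ₂₁))
    * exp (I * (x 1 - x 2) * (τ₂₁ + τ₂₂) + I * (x 0 - x 1) * τ₁₁)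
    * Gamma (I * (τ₂₁ - τ₁₁) + 1 / 2) * Gamma (I * (τ₂₂ - τ₁₁) + 1 / 2)
    * ∏ i : Fin 3, (Gamma (I * (γ i - τ₂₁) + 1 / 2) * Gamma (I * (γ i - τ₂₂) + 1 / 2))

/-- The Mellin-Barnes integral for the `gl₃(ℝ)`-Whittaker function, without the symmetry factor
`1 / 2!` that accounts for the permutations of `τ₂₁, τ₂₂`; here `ρ(x) = x₁ - x₃`. -/
def mellinBarnesIntegral (γ : Fin 3 → ℂ) (x : Fin 3 → ℝ) : ℂ :=
  exp (I * (γ 0 + γ 1 + γ 2) * x 2 - (x 0 - x 2)) / (2 * Real.pi : ℂ) ^ 3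
    * ∫ τ : ℝ × ℝ × ℝ, mellinBarnesIntegrand γ x τ

end

/-!
In each integral a linear change of variables leaves, as the inner integral, a classical beta
integral: Barnes' first lemma for the Gauss-Givental integral, the de Branges-Wilson integral for
the Mellin-Barnes integral. Both sides then become double integrals of the same meromorphic kernel
over contours that differ by a translation, and Cauchy's theorem identifies them because no pole
of the kernel lies between the two contours.

The de Branges-Wilson integral and its evaluation satisfy the same recurrence under `a ↦ a + 1`,
so their quotient is 1-periodic in `a`. It grows at most like `exp (6 * |a.im|)` on a strip of
width 1, and `6 < 2 * π`, so by Liouville's theorem on the cylinder `ℂ / ℤ` it is constant.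
Applying this to two parameters in turn reduces to `a = 1 / 2`, `b = 1`, where the duplication
formula turns the integral into a combination of two instances of Barnes' first lemma. The latter
is Parseval's identity for the Fourier transforms of two beta densities on the logistic scale.
-/

section

open Set Filter Asymptotics Topology

section Asymptotics

theorem isBigO_exp_of_le {α : Type*} {S : Set α} {f g : α → ℝ} (K : ℝ)
    (h : ∀ x ∈ S, f x ≤ g x + K) :
    (fun x ↦ Real.exp (f x)) =O[𝓟 S] fun x ↦ Real.exp (g x) := by
  refine isBigO_principal.2 ⟨Real.exp K, fun x hx ↦ ?_⟩
  rw [Real.norm_of_nonneg (Real.exp_pos _).le, Real.norm_of_nonneg (Real.exp_pos _).le,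
    ← Real.exp_add, add_comm]
  exact Real.exp_le_exp.2 (h x hx)

end Asymptotics

section Integrability

variable {E : Type*} [NormedAddCommGroup E] [NormedSpace ℝ E] [FiniteDimensional ℝ E]
  [MeasurableSpace E] [BorelSpace E] {μ : Measure E} [μ.IsAddHaarMeasure]
  {F : Type*} [NormedAddCommGroup F]

theorem integrable_exp_neg_mul_norm {c : ℝ} (hc : 0 < c) :
    Integrable (fun x : E ↦ Real.exp (-(c * ‖x‖))) μ := by
  set k := Module.finrank ℝ E + 1
  have hk : (Module.finrank ℝ E : ℝ) < k := by simp [k]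
  have hO : (fun x : E ↦ Real.exp (-(c * ‖x‖))) =O[⊤] fun x ↦ (1 + ‖x‖) ^ (-(k : ℝ)) := by
    refine isBigO_top.2 ⟨k.factorial / c ^ k * Real.exp c, fun x ↦ ?_⟩
    have hpow := Real.pow_div_factorial_le_exp (c * (1 + ‖x‖)) (by positivity) k
    rw [Real.norm_of_nonneg (by positivity), Real.norm_of_nonneg (by positivity),
      Real.rpow_neg (by positivity), Real.rpow_natCast, Real.exp_neg, ← div_eq_mul_inv,
      inv_le_iff_one_le_mul₀ (by positivity)]
    calc (1 : ℝ) = k.factorial / c ^ k / (1 + ‖x‖) ^ k * ((c * (1 + ‖x‖)) ^ k / k.factorial) := by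
          rw [mul_pow]; field_simp
      _ ≤ k.factorial / c ^ k / (1 + ‖x‖) ^ k * Real.exp (c * (1 + ‖x‖)) := by gcongr
      _ = k.factorial / c ^ k * Real.exp c / (1 + ‖x‖) ^ k * Real.exp (c * ‖x‖) := by
          rw [mul_add, mul_one, Real.exp_add]; ring
  exact (hO.mono le_top).integrable (by fun_prop) (integrable_one_add_norm hk)

theorem integrable_of_isBigO_exp_neg_norm {f : E → F} {c : ℝ} (hf : Continuous f)
    (hc : 0 < c) (hO : f =O[⊤] fun x ↦ Real.exp (-(c * ‖x‖))) : Integrable f μ :=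
  (hO.mono le_top).integrable hf.aestronglyMeasurable (integrable_exp_neg_mul_norm hc)

end Integrability

section ContourShift

variable {E : Type*} [NormedAddCommGroup E] {f : ℂ → E} {a b : ℝ}

theorem integrable_add_mul_I_of_isBigO_exp_neg {c : ℝ} (hc : 0 < c)
    (hf : ContinuousOn f (im ⁻¹' {a}))
    (hO : f =O[𝓟 (im ⁻¹' {a})] fun z ↦ Real.exp (-(c * |z.re|))) :
    Integrable fun x : ℝ ↦ f (x + a * I) := by
  have hline : ∀ x : ℝ, (x + a * I : ℂ) ∈ im ⁻¹' {a} := by simp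
  refine integrable_of_isBigO_exp_neg_norm (hf.comp_continuous (by fun_prop) hline) hc ?_
  simpa [Function.comp_def] using
    hO.comp_tendsto (tendsto_principal.2 (Eventually.of_forall hline) : Tendsto _ ⊤ _)

variable [NormedSpace ℂ E]

theorem tendsto_integral_add_mul_I_zero {ι : Type*} {l : Filter ι} {s : ι → ℝ}
    (hf : Tendsto f (comap re (cocompact ℝ) ⊓ 𝓟 (im ⁻¹' uIcc a b)) (𝓝 0))
    (hs : Tendsto s l (cocompact ℝ)) :
    Tendsto (fun i ↦ ∫ y in a..b, f (s i + y * I)) l (𝓝 0) := by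
  refine Metric.tendsto_nhds.2 fun ε hε ↦ ?_
  have hδ : 0 < ε / (|b - a| + 1) := by positivity
  have hsmall := eventually_inf_principal.1 (Metric.tendsto_nhds.1 hf _ hδ)
  filter_upwards [hs.eventually (eventually_comap.1 hsmall)] with i hi
  rw [dist_zero_right]
  calc ‖∫ y in a..b, f (s i + y * I)‖
      ≤ ε / (|b - a| + 1) * |b - a| :=
        intervalIntegral.norm_integral_le_of_norm_le_const fun y hy ↦ by
          simpa using (hi (s i + y * I) (by simp) (by simpa using uIoc_subset_uIcc hy)).le
    _ < ε := by
        rw [div_mul_eq_mul_div, div_lt_iff₀ (by positivity)]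
        exact mul_lt_mul_of_pos_left (lt_add_one _) hε

theorem integral_add_mul_I_eq [CompleteSpace E]
    (hd : ∀ z : ℂ, z.im ∈ uIcc a b → DifferentiableAt ℂ f z)
    (ha : Integrable fun x : ℝ ↦ f (x + a * I)) (hb : Integrable fun x : ℝ ↦ f (x + b * I))
    (hf : Tendsto f (comap re (cocompact ℝ) ⊓ 𝓟 (im ⁻¹' uIcc a b)) (𝓝 0)) :
    ∫ x : ℝ, f (x + a * I) = ∫ x : ℝ, f (x + b * I) := by
  have hrect (T : ℝ) : (∫ x in (-T)..T, f (x + a * I)) - (∫ x in (-T)..T, f (x + b * I))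
      + I • (∫ y in a..b, f (T + y * I)) - I • (∫ y in a..b, f ((-T : ℝ) + y * I)) = 0 := by
    simpa using integral_boundary_rect_eq_zero_of_differentiableOn f (-T + a * I) (T + b * I)
      fun z hz ↦ (hd z (by simpa using (mem_reProdIm.1 hz).2)).differentiableWithinAt
  have horizontal {y : ℝ} (h : Integrable fun x : ℝ ↦ f (x + y * I)) :
      Tendsto (fun T ↦ ∫ x in (-T)..T, f (x + y * I)) atTop (𝓝 (∫ x : ℝ, f (x + y * I))) :=
    intervalIntegral_tendsto_integral h tendsto_neg_atTop_atBot tendsto_id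
  have hright := tendsto_integral_add_mul_I_zero hf (tendsto_id'.2 atTop_le_cocompact)
  have hleft := tendsto_integral_add_mul_I_zero hf
    (tendsto_neg_atTop_atBot.mono_right atBot_le_cocompact)
  have hlim := (((horizontal ha).sub (horizontal hb)).add (hright.const_smul I)).sub
    (hleft.const_smul I)
  simpa [sub_eq_zero] using
    tendsto_nhds_unique (hlim.congr fun T ↦ hrect T) tendsto_const_nhds

theorem integral_add_mul_I_eq_of_isBigO_exp_neg [CompleteSpace E] {c : ℝ} (hc : 0 < c)
    (hd : ∀ z : ℂ, z.im ∈ uIcc a b → DifferentiableAt ℂ f z)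
    (hO : f =O[𝓟 (im ⁻¹' uIcc a b)] fun z ↦ Real.exp (-(c * |z.re|))) :
    ∫ x : ℝ, f (x + a * I) = ∫ x : ℝ, f (x + b * I) := by
  have hline {y : ℝ} (hy : y ∈ uIcc a b) : Integrable fun x : ℝ ↦ f (x + y * I) :=
    integrable_add_mul_I_of_isBigO_exp_neg hc
      (fun z hz ↦ (hd z (hz ▸ hy)).continuousAt.continuousWithinAt)
      (hO.mono (principal_mono.2 (preimage_mono (singleton_subset_iff.2 hy))))
  refine integral_add_mul_I_eq hd (hline left_mem_uIcc) (hline right_mem_uIcc)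
    ((hO.mono inf_le_right).trans_tendsto ?_)
  have hdecay : Tendsto (fun x : ℝ ↦ Real.exp (-(c * ‖x‖))) (cocompact ℝ) (𝓝 0) :=
    Real.tendsto_exp_neg_atTop_nhds_zero.comp (tendsto_norm_cocompact_atTop.const_mul_atTop hc)
  exact (hdecay.comp tendsto_comap).mono_left inf_le_left

end ContourShift

section ParametricIntegral

variable {α : Type*} [MeasurableSpace α] {μ : Measure α} {𝕜 E : Type*}
  [NontriviallyNormedField 𝕜] [NormedAddCommGroup E]

theorem aestronglyMeasurable_of_hasDerivAt [NormedSpace 𝕜 E] {F : 𝕜 → α → E} {F' : α → E} {a : 𝕜}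
    (hF : ∀ᶠ z in 𝓝 a, AEStronglyMeasurable (F z) μ)
    (hd : ∀ᵐ u ∂μ, HasDerivAt (F · u) (F' u) a) : AEStronglyMeasurable F' μ := by
  obtain ⟨z, hz⟩ := exists_seq_tendsto (𝓝[≠] a)
  obtain ⟨N, hN⟩ := eventually_atTop.1 ((hz.mono_right nhdsWithin_le_nhds).eventually hF)
  refine aestronglyMeasurable_of_tendsto_ae atTop
    (f := fun n u ↦ slope (F · u) a (z (n + N))) (fun n ↦ ?_) ?_
  · exact ((hN _ (Nat.le_add_left N n)).sub hF.self_of_nhds).const_smul (z (n + N) - a)⁻¹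
  · filter_upwards [hd] with u hu
    exact hu.tendsto_slope.comp (hz.comp (tendsto_add_atTop_nat N))

theorem differentiableOn_integral_of_norm_le [NormedSpace ℂ E] [CompleteSpace E] {U : Set ℂ}
    (hU : IsOpen U) {F : ℂ → α → E} {g : α → ℝ}
    (hd : ∀ᵐ u ∂μ, DifferentiableOn ℂ (F · u) U) (hm : ∀ a ∈ U, AEStronglyMeasurable (F a) μ)
    (hb : ∀ᵐ u ∂μ, ∀ a ∈ U, ‖F a u‖ ≤ g u) (hg : Integrable g μ) :
    DifferentiableOn ℂ (fun a ↦ ∫ u, F a u ∂μ) U := by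
  intro a ha
  obtain ⟨r, hr, hrU⟩ := Metric.nhds_basis_closedBall.mem_iff.1 (hU.mem_nhds ha)
  have hball : ∀ x ∈ Metric.ball a (r / 2), Metric.closedBall x (r / 2) ⊆ U := fun x hx ↦
    (Metric.closedBall_subset_closedBall' (by linarith [Metric.mem_ball.1 hx])).trans hrU
  have hderiv : ∀ᵐ u ∂μ, ∀ x ∈ Metric.ball a (r / 2), HasDerivAt (F · u) (deriv (F · u) x) x := by
    filter_upwards [hd] with u hu x hx
    have hxU : x ∈ U := hball x hx (Metric.mem_closedBall_self (by positivity))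
    exact (hu.differentiableAt (hU.mem_nhds hxU)).hasDerivAt
  have hmeas : ∀ᶠ x in 𝓝 a, AEStronglyMeasurable (F x) μ := by
    filter_upwards [hU.mem_nhds ha] with x hx using hm x hx
  have hmeas' : AEStronglyMeasurable (fun u ↦ deriv (F · u) a) μ :=
    aestronglyMeasurable_of_hasDerivAt hmeas
      (hderiv.mono fun u hu ↦ hu a (Metric.mem_ball_self (half_pos hr)))
  have hint : Integrable (F a) μ := hg.mono' (hm a ha) (hb.mono fun u hu ↦ hu a ha)
  have hcauchy : ∀ᵐ u ∂μ, ∀ x ∈ Metric.ball a (r / 2), ‖deriv (F · u) x‖ ≤ g u / (r / 2) := by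
    filter_upwards [hd, hb] with u hdu hbu x hx
    exact norm_deriv_le_of_forall_mem_sphere_norm_le (half_pos hr)
      ((hdu.mono (hball x hx)).diffContOnCl_ball subset_rfl) fun z hz ↦
      hbu z (hball x hx (Metric.sphere_subset_closedBall hz))
  exact (hasDerivAt_integral_of_dominated_loc_of_deriv_le (Metric.ball_mem_nhds a (half_pos hr))
    hmeas hint hmeas' hcauchy (hg.div_const _) hderiv).2.differentiableAt.differentiableWithinAt

end ParametricIntegral

section Liouville

theorem apply_eq_apply_of_isLittleO_id {E : Type*} [NormedAddCommGroup E] [NormedSpace ℂ E]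
    {f : ℂ → E} (hf : Differentiable ℂ f) (ho : f =o[cocompact ℂ] id) (z w : ℂ) : f z = f w := by
  refine is_const_of_deriv_eq_zero hf (fun z ↦ norm_le_zero_iff.1 ?_) z w
  refine le_of_forall_pos_le_add fun ε hε ↦ ?_
  rw [← Metric.cobounded_eq_cocompact, ← comap_norm_atTop] at ho
  obtain ⟨r, hr⟩ := eventually_atTop.1 (eventually_comap.1 (ho.def (half_pos hε)))
  set R := max 1 (max ‖z‖ (r + ‖z‖))
  have hRpos : 0 < R := lt_max_of_lt_left one_pos
  have hzR : ‖z‖ ≤ R := (le_max_left _ _).trans (le_max_right _ _)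
  have hrR : r + ‖z‖ ≤ R := (le_max_right _ _).trans (le_max_right _ _)
  have hsphere : ∀ u ∈ Metric.sphere z R, ‖f u‖ ≤ ε * R := fun u hu ↦ by
    rw [mem_sphere_iff_norm] at hu
    have hlower : r ≤ ‖u‖ := by linarith [norm_sub_le u z]
    have hupper : ‖u‖ ≤ 2 * R := by linarith [norm_le_norm_add_norm_sub' u z]
    calc ‖f u‖ ≤ ε / 2 * ‖u‖ := hr _ hlower u rfl
      _ ≤ ε / 2 * (2 * R) := by gcongr
      _ = ε * R := by ring
  calc ‖deriv f z‖ ≤ ε * R / R :=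
        norm_deriv_le_of_forall_mem_sphere_norm_le hRpos hf.diffContOnCl hsphere
    _ = 0 + ε := by field_simp; ring

open Function.Periodic in
theorem exp_two_pi_mul_abs_im_invQParam {h : ℝ} (hh : 0 < h) (q : ℂ) :
    Real.exp (2 * Real.pi * |(invQParam h q).im| / h) = Real.exp |Real.log ‖q‖| := by
  rw [im_invQParam, abs_mul, abs_div, abs_neg, abs_of_pos hh, abs_of_pos Real.two_pi_pos]
  field_simp

open Function.Periodic in
theorem isLittleO_cuspFunction_nhds_ne {F : ℂ → ℂ} {h : ℝ} (hh : 0 < h)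
    (ho : F =o[comap im atTop] fun z ↦ Real.exp (2 * Real.pi * |z.im| / h)) :
    cuspFunction h F =o[𝓝[≠] 0] fun q ↦ q⁻¹ := by
  refine ((ho.comp_tendsto (invQParam_tendsto hh)).congr' ?_ .rfl).trans_isBigO (.of_bound' ?_)
  · filter_upwards [self_mem_nhdsWithin] with q hq using (cuspFunction_eq_of_nonzero h F hq).symm
  · filter_upwards [self_mem_nhdsWithin, nhdsWithin_le_nhds (Metric.ball_mem_nhds 0 one_pos)]
      with q hq hball
    have hlog : Real.log ‖q‖ ≤ 0 :=
      Real.log_nonpos (norm_nonneg q) (mem_ball_zero_iff.1 hball).le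
    rw [Function.comp_apply, exp_two_pi_mul_abs_im_invQParam hh, abs_of_nonpos hlog, Real.exp_neg,
      Real.exp_log (norm_pos_iff.2 hq), norm_inv, norm_norm, norm_inv]

open Function.Periodic in
theorem isLittleO_cuspFunction_cocompact {F : ℂ → ℂ} {h : ℝ} (hh : 0 < h)
    (ho : F =o[comap im atBot] fun z ↦ Real.exp (2 * Real.pi * |z.im| / h)) :
    cuspFunction h F =o[cocompact ℂ] id := by
  have hlim : Tendsto (invQParam h) (cocompact ℂ) (comap im atBot) := by
    simp only [tendsto_comap_iff, Function.comp_def, im_invQParam]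
    exact (Real.tendsto_log_atTop.comp tendsto_norm_cocompact_atTop).const_mul_atTop_of_neg
      (div_neg_of_neg_of_pos (neg_lt_zero.2 hh) Real.two_pi_pos)
  have hlarge : ∀ᶠ q : ℂ in cocompact ℂ, 1 ≤ ‖q‖ :=
    tendsto_norm_cocompact_atTop.eventually_ge_atTop 1
  refine ((ho.comp_tendsto hlim).congr' ?_ .rfl).trans_isBigO (.of_bound' ?_)
  · filter_upwards [hlarge] with q hq
    exact (cuspFunction_eq_of_nonzero h F (norm_pos_iff.1 (one_pos.trans_le hq))).symm
  · filter_upwards [hlarge] with q hq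
    rw [Function.comp_apply, exp_two_pi_mul_abs_im_invQParam hh, abs_of_nonneg (Real.log_nonneg hq),
      Real.exp_log (one_pos.trans_le hq), norm_norm, id]

open Function.Periodic in
theorem apply_eq_apply_of_periodic_of_isLittleO {F : ℂ → ℂ} {h : ℝ} (hh : 0 < h)
    (hF : Differentiable ℂ F) (hper : Function.Periodic F h)
    (ho : F =o[comap im (cocompact ℝ)] fun z ↦ Real.exp (2 * Real.pi * |z.im| / h)) (z w : ℂ) :
    F z = F w := by
  have hd : DifferentiableOn ℂ (cuspFunction h F) (univ \ {0}) := fun q hq ↦ by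
    rw [← qParam_right_inv hh.ne' hq.2]
    exact (differentiableAt_cuspFunction hh.ne' hper hF.differentiableAt).differentiableWithinAt
  have hzero := isLittleO_cuspFunction_nhds_ne hh (ho.mono (comap_mono atTop_le_cocompact))
  have hinfty := isLittleO_cuspFunction_cocompact hh (ho.mono (comap_mono atBot_le_cocompact))
  have hconst : (fun _ ↦ cuspFunction h F 0) =o[𝓝[≠] 0] fun q : ℂ ↦ q⁻¹ :=
    isLittleO_const_left.2 (.inr tendsto_norm_inv_nhdsNE_zero_atTop)
  have hentire : Differentiable ℂ (cuspFunction h F) := by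
    have := differentiableOn_update_limUnder_of_isLittleO univ_mem hd (by
      simpa only [sub_zero] using hzero.sub hconst)
    rwa [← cuspFunction_zero_eq_limUnder_nhds_ne, Function.update_eq_self,
      differentiableOn_univ] at this
  rw [← eq_cuspFunction hh.ne' hper z, ← eq_cuspFunction hh.ne' hper w]
  exact apply_eq_apply_of_isLittleO_id hentire hinfty _ _

theorem exists_periodic_entire_extension {E : Type*} [NormedAddCommGroup E] [NormedSpace ℂ E]
    {F : ℂ → E} (hF : DifferentiableOn ℂ F {z | 0 < z.re})
    (hper : ∀ z : ℂ, 0 < z.re → F (z + 1) = F z) :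
    ∃ G : ℂ → E, Differentiable ℂ G ∧ Function.Periodic G 1 ∧ EqOn G F {z | 0 < z.re} := by
  have hnat (n : ℕ) (z : ℂ) (hz : 0 < z.re) : F (z + n) = F z := by
    induction n with
    | zero => simp
    | succ n ih => rw [Nat.cast_succ, ← add_assoc, hper _ (by simpa using by positivity), ih]
  have hint (m : ℤ) (z : ℂ) (hz : 0 < z.re) (hm : 0 < z.re + m) : F (z + m) = F z := by
    obtain ⟨n, rfl | rfl⟩ := m.eq_nat_or_neg
    · exact_mod_cast hnat n z hz
    · rw [← hnat n (z + _) (by simpa using hm)]; simp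
  set G : ℂ → E := fun z ↦ F (z + (1 - ⌊z.re⌋ : ℤ)) with hG
  have hpos (z : ℂ) : 0 < z.re + (1 - ⌊z.re⌋ : ℤ) := by
    push_cast; linarith [Int.floor_le z.re]
  have hGF (n : ℤ) (z : ℂ) (hn : 0 < z.re + n) : G z = F (z + n) := by
    have := hint (n - (1 - ⌊z.re⌋)) (z + (1 - ⌊z.re⌋ : ℤ)) (by simpa using hpos z)
      (by simpa using hn)
    simp only [hG]
    rw [← this]; push_cast; ring_nf
  refine ⟨G, fun z ↦ ?_, fun z ↦ ?_, fun z hz ↦ by simpa using hGF 0 z (by simpa using hz)⟩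
  · set n : ℤ := 1 - ⌊z.re⌋
    have hhalf : IsOpen {w : ℂ | 0 < w.re} := isOpen_lt continuous_const continuous_re
    have heq : G =ᶠ[𝓝 z] fun w ↦ F (w + n) := by
      have hopen : IsOpen {w : ℂ | 0 < w.re + n} := isOpen_lt continuous_const (by fun_prop)
      filter_upwards [hopen.mem_nhds (hpos z)] with w hw using hGF n w hw
    refine heq.differentiableAt_iff.2 (DifferentiableAt.comp (g := F) z ?_ (by fun_prop))
    exact hF.differentiableAt (hhalf.mem_nhds (by simpa [n] using hpos z))
  · simp only [hG, add_re, one_re, Int.floor_add_one]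
    push_cast; ring_nf

theorem apply_eq_apply_of_periodic_of_isBigO_strip {F : ℂ → ℂ} {c : ℝ} (hc : c < 2 * Real.pi)
    (hF : DifferentiableOn ℂ F {z | 0 < z.re}) (hper : ∀ z : ℂ, 0 < z.re → F (z + 1) = F z)
    (hO : F =O[𝓟 (re ⁻¹' Icc 1 2)] fun z ↦ Real.exp (c * |z.im|)) {z w : ℂ}
    (hz : 0 < z.re) (hw : 0 < w.re) : F z = F w := by
  obtain ⟨G, hG, hGper, hGF⟩ := exists_periodic_entire_extension hF hper
  obtain ⟨C, hC⟩ := isBigO_principal.1 hO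
  have hGO : G =O[⊤] fun z ↦ Real.exp (c * |z.im|) := isBigO_top.2 ⟨C, fun z ↦ by
    set u : ℂ := z + (1 - ⌊z.re⌋ : ℤ) with hu
    have hre : u.re = 1 + Int.fract z.re := by
      simp only [hu, add_re, intCast_re, Int.fract]; push_cast; ring
    have him : u.im = z.im := by simp [hu]
    have hGu : G u = G z := by simpa [hu] using hGper.int_mul (1 - ⌊z.re⌋) z
    have hnonneg := Int.fract_nonneg z.re
    have hlt := Int.fract_lt_one z.re
    rw [← hGu, hGF (show 0 < u.re by linarith), ← him]
    exact hC u ⟨by linarith, by linarith⟩⟩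
  have hlittle : (fun z : ℂ ↦ Real.exp (c * |z.im|)) =o[comap im (cocompact ℝ)]
      fun z ↦ Real.exp (2 * Real.pi * |z.im| / 1) := by
    refine Real.isLittleO_exp_comp_exp_comp.2 ?_
    have := (tendsto_norm_cocompact_atTop (E := ℝ)).const_mul_atTop (sub_pos.2 hc)
    refine (this.comp tendsto_comap).congr fun z ↦ ?_
    simp only [Function.comp_apply, Real.norm_eq_abs]; ring
  rw [← hGF hz, ← hGF hw]
  exact apply_eq_apply_of_periodic_of_isLittleO one_pos hG (by simpa using hGper)
    ((hGO.mono le_top).trans_isLittleO hlittle) z w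

end Liouville

section GammaBounds

theorem differentiableAt_Gamma_of_re_pos {z : ℂ} (hz : 0 < z.re) : DifferentiableAt ℂ Gamma z :=
  differentiableAt_Gamma z fun m h ↦ by
    have hm : z.re = -m := by simp [h]
    linarith [m.cast_nonneg (α := ℝ)]

theorem norm_cpow_sub_one_mul_exp_neg {a r : ℂ} {t : ℝ} (ht : 0 < t) :
    ‖(t : ℂ) ^ (a - 1) * exp (-(r * t))‖ = t ^ (a.re - 1) * Real.exp (-(r.re * t)) := by
  rw [norm_mul, norm_cpow_eq_rpow_re_of_pos ht, norm_exp]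
  simp

theorem integrableOn_rpow_sub_one_mul_exp_neg_mul {a r : ℝ} (ha : 0 < a) (hr : 0 < r) :
    IntegrableOn (fun t : ℝ ↦ t ^ (a - 1) * Real.exp (-(r * t))) (Ioi 0) := by
  simpa using integrableOn_rpow_mul_exp_neg_mul_rpow (s := a - 1) (p := 1) (by linarith) one_pos hr

theorem differentiableOn_integral_cpow_mul_exp_neg_mul_Ioi {a : ℂ} (ha : 0 < a.re) {ε : ℝ}
    (hε : 0 < ε) : DifferentiableOn ℂ
      (fun r : ℂ ↦ ∫ t : ℝ in Ioi 0, (t : ℂ) ^ (a - 1) * exp (-(r * t))) {r | ε < r.re} := by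
  refine differentiableOn_integral_of_norm_le (isOpen_lt continuous_const continuous_re)
    (.of_forall fun u ↦ by fun_prop) (fun r _ ↦ ContinuousOn.aestronglyMeasurable ?_
      measurableSet_Ioi) ?_ (integrableOn_rpow_sub_one_mul_exp_neg_mul ha hε)
  · exact (continuous_ofReal.continuousOn.cpow_const fun t ht ↦ .inl (by simpa using ht)).mul
      (by fun_prop)
  · filter_upwards [ae_restrict_mem measurableSet_Ioi] with t ht r hr
    rw [norm_cpow_sub_one_mul_exp_neg ht]
    have ht0 : 0 < t := ht
    gcongr

theorem integral_cpow_mul_exp_neg_mul_Ioi_of_re_pos {a r : ℂ} (ha : 0 < a.re) (hr : 0 < r.re) :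
    ∫ t : ℝ in Ioi 0, (t : ℂ) ^ (a - 1) * exp (-(r * t)) = r ^ (-a) * Gamma a := by
  set U : Set ℂ := {z | r.re / 2 < z.re}
  have hU : IsOpen U := isOpen_lt continuous_const continuous_re
  have hpos : ∀ z ∈ U, 0 < z.re := fun z hz ↦ (half_pos hr).trans hz
  have hleft := differentiableOn_integral_cpow_mul_exp_neg_mul_Ioi ha (half_pos hr)
  have hright : DifferentiableOn ℂ (fun r : ℂ ↦ r ^ (-a) * Gamma a) U := fun z hz ↦
    ((differentiableAt_id.cpow_const (.inl (hpos z hz))).mul_const _).differentiableWithinAt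
  have hreal (x : ℝ) (hx : 0 < x) :
      ∫ t : ℝ in Ioi 0, (t : ℂ) ^ (a - 1) * exp (-(x * t)) = (x : ℂ) ^ (-a) * Gamma a := by
    rw [integral_cpow_mul_exp_neg_mul_Ioi ha hx, one_div, cpow_neg, inv_cpow_eq_ite,
      if_neg (by rw [arg_ofReal_of_nonneg hx.le]; exact Real.pi_ne_zero.symm)]
  have hmaps : Tendsto ((↑) : ℝ → ℂ) (𝓝[≠] r.re) (𝓝[≠] (r.re : ℂ)) :=
    continuous_ofReal.continuousWithinAt.tendsto_nhdsWithin fun x hx ↦ by simpa using hx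
  have hfreq : ∃ᶠ z in 𝓝[≠] (r.re : ℂ),
      ∫ t : ℝ in Ioi 0, (t : ℂ) ^ (a - 1) * exp (-(z * t)) = z ^ (-a) * Gamma a :=
    hmaps.frequently
      (((eventually_gt_nhds hr).filter_mono nhdsWithin_le_nhds).mono hreal).frequently
  exact (hleft.analyticOnNhd hU).eqOn_of_preconnected_of_frequently_eq (hright.analyticOnNhd hU)
    (convex_halfSpace_re_gt _).isPreconnected
    (show r.re / 2 < (r.re : ℂ).re by simpa using hr) hfreq (show r.re / 2 < r.re by linarith)

theorem norm_Gamma_le {z : ℂ} (hz : 0 < z.re) {κ : ℝ} (hκ₀ : 0 ≤ κ) (hκ : κ < Real.pi / 2) :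
    ‖Gamma z‖ ≤ (1 / Real.cos κ) ^ z.re * Real.Gamma z.re * Real.exp (-(κ * |z.im|)) := by
  obtain ⟨θ, hθ, hθκ⟩ : ∃ θ : ℝ, |θ| = κ ∧ θ * z.im = κ * |z.im| := by
    rcases le_total 0 z.im with h | h
    · exact ⟨κ, abs_of_nonneg hκ₀, by rw [abs_of_nonneg h]⟩
    · exact ⟨-κ, by rw [abs_neg, abs_of_nonneg hκ₀], by rw [abs_of_nonpos h]; ring⟩
  obtain ⟨hlower, hupper⟩ := abs_lt.1 (hθ.trans_lt hκ)
  have hcos : 0 < Real.cos κ := Real.cos_pos_of_mem_Ioo ⟨by linarith, hκ⟩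
  set r : ℂ := exp (θ * I) with hr
  have hr_re : r.re = Real.cos κ := by rw [hr, exp_ofReal_mul_I_re, ← hθ, Real.cos_abs]
  have hr_arg : arg r = θ := by
    rw [hr, exp_mul_I, arg_cos_add_sin_mul_I ⟨by linarith, by linarith⟩]
  have hcpow : ‖r ^ (-z)‖ = Real.exp (κ * |z.im|) := by
    rw [norm_cpow_of_ne_zero (exp_ne_zero _), hr_arg, norm_exp_ofReal_mul_I, Real.one_rpow,
      neg_im, mul_neg, hθκ, Real.exp_neg, one_div, inv_inv]
  have hint : ‖∫ t : ℝ in Ioi 0, (t : ℂ) ^ (z - 1) * exp (-(r * t))‖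
      ≤ (1 / Real.cos κ) ^ z.re * Real.Gamma z.re := by
    rw [← Real.integral_rpow_mul_exp_neg_mul_Ioi hz hcos, ← hr_re]
    refine (norm_integral_le_integral_norm _).trans_eq ?_
    exact setIntegral_congr_fun measurableSet_Ioi fun t ht ↦ norm_cpow_sub_one_mul_exp_neg ht
  rw [integral_cpow_mul_exp_neg_mul_Ioi_of_re_pos hz (hr_re ▸ hcos), norm_mul, hcpow] at hint
  rwa [Real.exp_neg, ← div_eq_mul_inv, le_div_iff₀ (Real.exp_pos _), mul_comm]

theorem isBigO_Gamma {δ : ℝ} (hδ : 0 < δ) (M : ℝ) {κ : ℝ} (hκ₀ : 0 ≤ κ) (hκ : κ < Real.pi / 2) :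
    Gamma =O[𝓟 (re ⁻¹' Icc δ M)] fun z ↦ Real.exp (-(κ * |z.im|)) := by
  have hcos : 0 < Real.cos κ := Real.cos_pos_of_mem_Ioo ⟨by linarith, hκ⟩
  have hcont : ContinuousOn (fun x ↦ (1 / Real.cos κ) ^ x * Real.Gamma x) (Icc δ M) := by
    refine (Real.continuous_const_rpow (by positivity)).continuousOn.mul fun x hx ↦
      (Real.differentiableAt_Gamma fun m hm ↦ ?_).continuousAt.continuousWithinAt
    linarith [hx.1, m.cast_nonneg (α := ℝ)]
  obtain ⟨K, hK⟩ := isCompact_Icc.bddAbove_image hcont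
  refine isBigO_principal.2 ⟨K, fun z hz ↦ ?_⟩
  rw [Real.norm_of_nonneg (Real.exp_pos _).le]
  refine (norm_Gamma_le (hδ.trans_le hz.1) hκ₀ hκ).trans ?_
  gcongr
  exact hK (mem_image_of_mem _ hz)

theorem norm_sin_le_exp_abs_im (z : ℂ) : ‖sin z‖ ≤ Real.exp |z.im| := by
  rw [Complex.sin, norm_div, norm_mul, norm_I, mul_one, Complex.norm_two, div_le_iff₀ two_pos]
  calc ‖exp (-z * I) - exp (z * I)‖
      ≤ ‖exp (-z * I)‖ + ‖exp (z * I)‖ := norm_sub_le _ _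
    _ = Real.exp z.im + Real.exp (-z.im) := by simp [norm_exp]
    _ ≤ Real.exp |z.im| + Real.exp |z.im| := by
        gcongr
        exacts [le_abs_self _, neg_le_abs _]
    _ = Real.exp |z.im| * 2 := by ring

theorem norm_Gamma_le_norm_Gamma_add_natCast {z : ℂ} (hz : 1 ≤ |z.im|) (k : ℕ) :
    ‖Gamma z‖ ≤ ‖Gamma (z + k)‖ := by
  induction k with
  | zero => simp
  | succ k ih =>
    have hone : 1 ≤ ‖z + k‖ := hz.trans (by simpa using abs_im_le_norm (z + k))
    have hne : z + k ≠ 0 := norm_pos_iff.1 (one_pos.trans_le hone)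
    rw [Nat.cast_succ, ← add_assoc, Gamma_add_one _ hne, norm_mul]
    exact ih.trans (le_mul_of_one_le_left (norm_nonneg _) hone)

theorem inv_Gamma_eq {z : ℂ} (hz : z.im ≠ 0) :
    (Gamma z)⁻¹ = Gamma (1 - z) * sin (Real.pi * z) / Real.pi := by
  have hne : Gamma z ≠ 0 := Gamma_ne_zero fun m h ↦ hz (by simp [h])
  have hsin : sin (Real.pi * z) ≠ 0 := fun h ↦ by
    obtain ⟨k, hk⟩ := sin_eq_zero_iff.1 h
    have := congrArg im hk
    simp [Real.pi_ne_zero, hz] at this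
  have hpi : (Real.pi : ℂ) ≠ 0 := ofReal_ne_zero.2 Real.pi_ne_zero
  rw [eq_div_iff hpi, inv_mul_eq_iff_eq_mul₀ hne, ← mul_assoc, Gamma_mul_Gamma_one_sub,
    div_mul_cancel₀ _ hsin]

theorem isBigO_inv_Gamma_of_one_le_abs_im (m M : ℝ) {κ : ℝ} (hκ : Real.pi / 2 < κ) :
    (fun z ↦ (Gamma z)⁻¹) =O[𝓟 (re ⁻¹' Icc m M ∩ {z | 1 ≤ |z.im|})]
      fun z ↦ Real.exp (κ * |z.im|) := by
  set ρ := max 0 (Real.pi - κ)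
  have hρ : ρ < Real.pi / 2 := max_lt (by positivity) (by linarith)
  have hρκ : Real.pi - ρ ≤ κ := by linarith [le_max_right 0 (Real.pi - κ)]
  obtain ⟨k, hk⟩ := exists_nat_ge M
  obtain ⟨C, hC⟩ := isBigO_principal.1
    (isBigO_Gamma one_pos (1 - m + k) (le_max_left 0 (Real.pi - κ)) hρ)
  have hC' (z : ℂ) (hz : z ∈ re ⁻¹' Icc m M ∩ {z | 1 ≤ |z.im|}) :
      ‖Gamma (1 - z)‖ ≤ C * Real.exp (-(ρ * |z.im|)) := by
    have him : 1 ≤ |(1 - z).im| := by simpa using hz.2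
    have hre : (1 - z + k).re ∈ Icc 1 (1 - m + k) := by
      simp only [add_re, sub_re, one_re, natCast_re]
      exact ⟨by linarith [hz.1.2], by linarith [hz.1.1]⟩
    simpa using (norm_Gamma_le_norm_Gamma_add_natCast him k).trans (hC _ hre)
  refine isBigO_principal.2 ⟨C / Real.pi, fun z hz ↦ ?_⟩
  have hC₀ : 0 ≤ C := nonneg_of_mul_nonneg_left ((norm_nonneg _).trans (hC' z hz)) (Real.exp_pos _)
  have hz₀ : z.im ≠ 0 := abs_pos.1 (one_pos.trans_le hz.2)
  have hsin : ‖sin (Real.pi * z)‖ ≤ Real.exp (Real.pi * |z.im|) := by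
    simpa [abs_mul, abs_of_pos Real.pi_pos] using norm_sin_le_exp_abs_im (Real.pi * z)
  rw [inv_Gamma_eq hz₀, norm_div, norm_mul, norm_real, Real.norm_of_nonneg Real.pi_pos.le,
    Real.norm_of_nonneg (Real.exp_pos _).le]
  calc ‖Gamma (1 - z)‖ * ‖sin (Real.pi * z)‖ / Real.pi
      ≤ C * Real.exp (-(ρ * |z.im|)) * Real.exp (Real.pi * |z.im|) / Real.pi := by
        gcongr; exact hC' z hz
    _ = C / Real.pi * Real.exp ((Real.pi - ρ) * |z.im|) := by
        rw [sub_mul, sub_eq_add_neg, Real.exp_add]; ring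
    _ ≤ C / Real.pi * Real.exp (κ * |z.im|) := by gcongr

theorem isBigO_inv_Gamma (m M : ℝ) {κ : ℝ} (hκ : Real.pi / 2 < κ) :
    (fun z ↦ (Gamma z)⁻¹) =O[𝓟 (re ⁻¹' Icc m M)] fun z ↦ Real.exp (κ * |z.im|) := by
  have hcompact : IsCompact (Icc m M ×ℂ Icc (-1) 1) := isCompact_Icc.reProdIm isCompact_Icc
  have hlow : (fun z ↦ (Gamma z)⁻¹) =O[𝓟 (Icc m M ×ℂ Icc (-1) 1)] fun _ ↦ (1 : ℝ) :=
    differentiable_one_div_Gamma.continuous.continuousOn.isBigO_principal hcompact (by simp)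
  have hone : (fun _ ↦ (1 : ℝ)) =O[𝓟 (Icc m M ×ℂ Icc (-1) 1)] fun z ↦ Real.exp (κ * |z.im|) :=
    isBigO_of_le _ fun z ↦ by
      have : 0 ≤ κ := (Real.pi_div_two_pos.trans hκ).le
      rw [norm_one, Real.norm_of_nonneg (Real.exp_pos _).le]
      exact Real.one_le_exp (by positivity)
  refine ((hlow.trans hone).sup (isBigO_inv_Gamma_of_one_le_abs_im m M hκ)).mono ?_
  rw [sup_principal, le_principal_iff]
  intro z hz
  rcases le_total |z.im| 1 with h | h
  · exact .inl ⟨hz, abs_le.1 h⟩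
  · exact .inr ⟨hz, h⟩

theorem isBigO_Gamma_comp {X : Type*} {S : Set X} {g : X → ℂ} {h : X → ℝ} {δ M κ K : ℝ}
    (hδ : 0 < δ) (hκ₀ : 0 ≤ κ) (hκ : κ < Real.pi / 2) (hre : ∀ x ∈ S, (g x).re ∈ Icc δ M)
    (him : ∀ x ∈ S, h x ≤ |(g x).im| + K) :
    (fun x ↦ Gamma (g x)) =O[𝓟 S] fun x ↦ Real.exp (-(κ * h x)) :=
  ((isBigO_Gamma hδ M hκ₀ hκ).comp_tendsto (tendsto_principal_principal.2 hre)).trans <|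
    isBigO_exp_of_le (κ * K) fun x hx ↦ by nlinarith [him x hx]

theorem isBigO_inv_Gamma_comp {X : Type*} {S : Set X} {g : X → ℂ} {h : X → ℝ} {m M κ K : ℝ}
    (hκ : Real.pi / 2 < κ) (hre : ∀ x ∈ S, (g x).re ∈ Icc m M)
    (him : ∀ x ∈ S, |(g x).im| ≤ h x + K) :
    (fun x ↦ (Gamma (g x))⁻¹) =O[𝓟 S] fun x ↦ Real.exp (κ * h x) :=
  ((isBigO_inv_Gamma m M hκ).comp_tendsto (tendsto_principal_principal.2 hre)).trans <|
    isBigO_exp_of_le (κ * K) fun x hx ↦ by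
      nlinarith [him x hx, (Real.pi_div_two_pos.trans hκ).le]

end GammaBounds

section Barnes

open scoped FourierTransform

theorem integral_fourier_mul_fourier {V : Type*} [NormedAddCommGroup V] [InnerProductSpace ℝ V]
    [FiniteDimensional ℝ V] [MeasurableSpace V] [BorelSpace V] {f g : V → ℂ} (hf : Integrable f)
    (hg : Integrable g) (hg_cont : Continuous g) (hg_fourier : Integrable (𝓕 g)) :
    ∫ ξ, 𝓕 f ξ * 𝓕 g ξ = ∫ v, f v * g (-v) := by
  have hflip : ∫ ξ, 𝓕 f ξ • 𝓕 g ξ = ∫ v, f v • 𝓕 (𝓕 g) v := by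
    simpa using! VectorFourier.integral_fourierIntegral_smul_eq_flip (L := innerₗ V)
      Real.continuous_fourierChar continuous_inner hf hg_fourier
  have hinv (v : V) : 𝓕 (𝓕 g) v = g (-v) := by
    have h := congrFun (hg_cont.fourierInv_fourier_eq hg hg_fourier) (-v)
    rwa [Real.fourierInv_eq_fourier_neg, neg_neg] at h
  simpa only [smul_eq_mul, hinv] using hflip

/-- The integrand `x ^ a * (1 - x) ^ c` of the Beta integral with respect to `dx / (x * (1 - x))`,
pulled back to the real line by the logistic function `x = σ v`, so that `1 - x = σ (-v)`. In this
coordinate the Beta integral becomes a Fourier transform. -/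
noncomputable def logisticBeta (a c : ℂ) (v : ℝ) : ℂ :=
  (Real.sigmoid v : ℂ) ^ a * (Real.sigmoid (-v) : ℂ) ^ c

theorem ofReal_sigmoid_ne_zero (v : ℝ) : (Real.sigmoid v : ℂ) ≠ 0 :=
  ofReal_ne_zero.2 (Real.sigmoid_pos v).ne'

theorem continuous_logisticBeta (a c : ℂ) : Continuous (logisticBeta a c) := by
  have hcpow (s : ℂ) : Continuous fun v ↦ (Real.sigmoid v : ℂ) ^ s :=
    (continuous_ofReal.comp continuous_sigmoid).cpow continuous_const
      fun v ↦ .inl (Real.sigmoid_pos v)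
  exact (hcpow a).mul ((hcpow c).comp continuous_neg)

theorem logisticBeta_neg (a c : ℂ) (v : ℝ) : logisticBeta a c (-v) = logisticBeta c a v := by
  rw [logisticBeta, logisticBeta, neg_neg, mul_comm]

theorem logisticBeta_mul (a b c d : ℂ) (v : ℝ) :
    logisticBeta a c v * logisticBeta b d v = logisticBeta (a + b) (c + d) v := by
  rw [logisticBeta, logisticBeta, logisticBeta, cpow_add _ _ (ofReal_sigmoid_ne_zero v),
    cpow_add _ _ (ofReal_sigmoid_ne_zero (-v))]
  ring

theorem logisticBeta_neg_right (s : ℂ) (v : ℝ) : logisticBeta s (-s) v = exp (s * v) := by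
  have hlog : Real.log (Real.sigmoid v) - Real.log (Real.sigmoid (-v)) = v := by
    rw [← Real.sigmoid_mul_rexp_neg, Real.log_mul (Real.sigmoid_pos v).ne' (Real.exp_pos _).ne',
      Real.log_exp]
    ring
  rw [logisticBeta, cpow_def_of_ne_zero (ofReal_sigmoid_ne_zero v),
    cpow_def_of_ne_zero (ofReal_sigmoid_ne_zero (-v)), ← ofReal_log (Real.sigmoid_nonneg v),
    ← ofReal_log (Real.sigmoid_nonneg (-v)), ← exp_add]
  nth_rw 3 [← hlog]
  push_cast
  ring_nf

theorem logisticBeta_eq_abs_deriv_smul (a c : ℂ) (v : ℝ) : logisticBeta a c v =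
    |Real.sigmoid v * (1 - Real.sigmoid v)| •
      ((Real.sigmoid v : ℂ) ^ (a - 1) * (1 - (Real.sigmoid v : ℂ)) ^ (c - 1)) := by
  have hone_sub : 1 - (Real.sigmoid v : ℂ) = Real.sigmoid (-v) := by simp [Real.sigmoid_neg]
  rw [← Real.sigmoid_neg, abs_of_pos (mul_pos (Real.sigmoid_pos v) (Real.sigmoid_pos (-v))),
    hone_sub, cpow_sub _ _ (ofReal_sigmoid_ne_zero v), cpow_sub _ _ (ofReal_sigmoid_ne_zero (-v)),
    cpow_one, cpow_one, logisticBeta, real_smul, ofReal_mul]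
  have := ofReal_sigmoid_ne_zero v
  have := ofReal_sigmoid_ne_zero (-v)
  field_simp

theorem integrable_logisticBeta {a c : ℂ} (ha : 0 < a.re) (hc : 0 < c.re) :
    Integrable (logisticBeta a c) := by
  have h := betaIntegral_convergent ha hc
  rw [intervalIntegrable_iff_integrableOn_Ioo_of_le zero_le_one, ← Real.range_sigmoid,
    ← image_univ, integrableOn_image_iff_integrableOn_abs_deriv_smul MeasurableSet.univ
      (fun x _ ↦ (Real.hasDerivAt_sigmoid x).hasDerivWithinAt) Real.sigmoid_injective.injOn,
    integrableOn_univ] at h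
  simpa only [← logisticBeta_eq_abs_deriv_smul] using h

theorem integral_logisticBeta {a c : ℂ} (ha : 0 < a.re) (hc : 0 < c.re) :
    ∫ v, logisticBeta a c v = Gamma a * Gamma c / Gamma (a + c) := by
  rw [← betaIntegral_eq_Gamma_mul_div a c ha hc, betaIntegral,
    intervalIntegral.integral_of_le zero_le_one, integral_Ioc_eq_integral_Ioo,
    ← Real.range_sigmoid, ← image_univ, integral_image_eq_integral_abs_deriv_smul
      MeasurableSet.univ (fun x _ ↦ (Real.hasDerivAt_sigmoid x).hasDerivWithinAt)
      Real.sigmoid_injective.injOn, setIntegral_univ]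
  simp only [← logisticBeta_eq_abs_deriv_smul]

theorem fourier_logisticBeta {a c : ℂ} (ha : 0 < a.re) (hc : 0 < c.re) (ξ : ℝ) :
    𝓕 (logisticBeta a c) ξ = Gamma (a - I * (2 * Real.pi * ξ : ℝ)) *
      Gamma (c + I * (2 * Real.pi * ξ : ℝ)) / Gamma (a + c) := by
  set s : ℂ := I * (2 * Real.pi * ξ : ℝ) with hs
  have htwist (v : ℝ) : exp (↑(-2 * Real.pi * v * ξ) * I) • logisticBeta a c v
      = logisticBeta (a - s) (c + s) v := by
    rw [show ↑(-2 * Real.pi * v * ξ) * I = -s * v by rw [hs]; push_cast; ring,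
      ← logisticBeta_neg_right, smul_eq_mul, logisticBeta_mul, neg_neg, neg_add_eq_sub,
      add_comm s c]
  rw [Real.fourier_real_eq_integral_exp_smul]
  simp_rw [htwist]
  rw [integral_logisticBeta (by simpa [hs] using ha) (by simpa [hs] using hc),
    sub_add_add_cancel]

theorem isBigO_Gamma_add_mul_Gamma_sub {a c : ℂ} {r : ℝ} (ha : r < a.re) (hc : r < c.re) :
    (fun w ↦ Gamma (a + I * w) * Gamma (c - I * w)) =O[𝓟 (im ⁻¹' Icc (-r) r)]
      fun w ↦ Real.exp (-(3 * |w.re|)) := by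
  have hκ : (3 / 2 : ℝ) < Real.pi / 2 := by linarith [Real.pi_gt_three]
  have hplus := isBigO_Gamma_comp (S := im ⁻¹' Icc (-r) r) (g := fun w ↦ a + I * w)
    (h := fun w ↦ |w.re|) (M := a.re + r) (K := |a.im|) (sub_pos.2 ha) (by norm_num) hκ
    (fun w hw ↦ by
      rw [mem_Icc, show (a + I * w).re = a.re - w.im by simp [sub_eq_add_neg]]
      exact ⟨by linarith [hw.2], by linarith [hw.1]⟩) fun w _ ↦ by
      simpa [add_comm] using abs_sub_abs_le_abs_sub w.re (-a.im)
  have hminus := isBigO_Gamma_comp (S := im ⁻¹' Icc (-r) r) (g := fun w ↦ c - I * w)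
    (h := fun w ↦ |w.re|) (M := c.re + r) (K := |c.im|) (sub_pos.2 hc) (by norm_num) hκ
    (fun w hw ↦ by simpa [sub_eq_add_neg] using hw) fun w _ ↦ by
      simpa [abs_sub_comm] using abs_sub_abs_le_abs_sub w.re c.im
  refine (hplus.mul hminus).congr_right fun w ↦ ?_
  rw [← Real.exp_add]
  ring_nf

theorem isBigO_Gamma_add_mul_Gamma_sub_ofReal {a c : ℂ} (ha : 0 < a.re) (hc : 0 < c.re) :
    (fun s : ℝ ↦ Gamma (a + I * s) * Gamma (c - I * s)) =O[⊤] fun s ↦ Real.exp (-(3 * ‖s‖)) :=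
  (isBigO_Gamma_add_mul_Gamma_sub ha hc).comp_tendsto (k := ((↑) : ℝ → ℂ))
    (tendsto_principal.2 (.of_forall (by simp)))

theorem continuous_Gamma_comp {X : Type*} [TopologicalSpace X] {f : X → ℂ} (hf : Continuous f)
    (hre : ∀ x, 0 < (f x).re) : Continuous fun x ↦ Gamma (f x) :=
  continuous_iff_continuousAt.2 fun x ↦
    (differentiableAt_Gamma_of_re_pos (hre x)).continuousAt.comp (f := f) hf.continuousAt

theorem integrable_Gamma_add_mul_Gamma_sub {a c : ℂ} (ha : 0 < a.re) (hc : 0 < c.re) :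
    Integrable fun s : ℝ ↦ Gamma (a + I * s) * Gamma (c - I * s) :=
  integrable_of_isBigO_exp_neg_norm
    ((continuous_Gamma_comp (by fun_prop) (by simpa using ha)).mul
      (continuous_Gamma_comp (by fun_prop) (by simpa using hc)))
    three_pos (isBigO_Gamma_add_mul_Gamma_sub_ofReal ha hc)

theorem integrable_fourier_logisticBeta {a c : ℂ} (ha : 0 < a.re) (hc : 0 < c.re) :
    Integrable (𝓕 (logisticBeta a c)) := by
  refine (((integrable_Gamma_add_mul_Gamma_sub hc ha).comp_mul_left' (R := 2 * Real.pi)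
    (by positivity)).div_const (Gamma (a + c))).congr (.of_forall fun ξ ↦ ?_)
  dsimp only
  rw [fourier_logisticBeta ha hc, mul_comm (Gamma (c + _))]

theorem integral_barnes_first {a b c d : ℂ} (ha : 0 < a.re) (hb : 0 < b.re) (hc : 0 < c.re)
    (hd : 0 < d.re) :
    ∫ s : ℝ, Gamma (a + I * s) * Gamma (b + I * s) * Gamma (c - I * s) * Gamma (d - I * s)
      = 2 * Real.pi * (Gamma (a + c) * Gamma (a + d) * Gamma (b + c) * Gamma (b + d)
        / Gamma (a + b + c + d)) := by
  set G : ℝ → ℂ := fun s ↦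
    Gamma (a + I * s) * Gamma (b + I * s) * Gamma (c - I * s) * Gamma (d - I * s)
  have hca : Gamma (c + a) ≠ 0 := Gamma_ne_zero_of_re_pos (by simpa using add_pos hc ha)
  have hdb : Gamma (d + b) ≠ 0 := Gamma_ne_zero_of_re_pos (by simpa using add_pos hd hb)
  have hfourier (ξ : ℝ) : 𝓕 (logisticBeta c a) ξ * 𝓕 (logisticBeta d b) ξ
      = G (2 * Real.pi * ξ) / (Gamma (c + a) * Gamma (d + b)) := by
    rw [fourier_logisticBeta hc ha, fourier_logisticBeta hd hb]
    ring
  have hmul (v : ℝ) : logisticBeta c a v * logisticBeta d b (-v)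
      = logisticBeta (c + b) (a + d) v := by rw [logisticBeta_neg, logisticBeta_mul]
  have hparseval := integral_fourier_mul_fourier (integrable_logisticBeta hc ha)
    (integrable_logisticBeta hd hb) (continuous_logisticBeta d b)
    (integrable_fourier_logisticBeta hd hb)
  simp only [hfourier, hmul] at hparseval
  rw [integral_logisticBeta (by simpa using add_pos hc hb) (by simpa using add_pos ha hd),
    integral_div, Measure.integral_comp_mul_left G, abs_of_pos (by positivity), real_smul,
    div_eq_iff (mul_ne_zero hca hdb), ofReal_inv, inv_mul_eq_iff_eq_mul₀
      (ofReal_ne_zero.2 (by positivity))] at hparseval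
  rw [hparseval, show a + b + c + d = c + b + (a + d) by ring, add_comm a c, add_comm b c,
    add_comm b d]
  push_cast
  ring

end Barnes

section GammaPair

/-- The product `Γ(a + iw) Γ(a - iw)`, written `Γ(a ± iw)` in the theory of Wilson polynomials, from
which the de Branges-Wilson integral is built. -/
noncomputable def gammaPair (a w : ℂ) : ℂ := Gamma (a + I * w) * Gamma (a - I * w)

theorem continuous_gammaPair {a : ℂ} (ha : 0 < a.re) : Continuous fun u : ℝ ↦ gammaPair a u :=
  (continuous_Gamma_comp (by fun_prop) (by simpa using ha)).mul
    (continuous_Gamma_comp (by fun_prop) (by simpa using ha))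

theorem differentiableAt_gammaPair {a w : ℂ} (hw : |w.im| < a.re) :
    DifferentiableAt ℂ (gammaPair a) w := by
  obtain ⟨hlower, hupper⟩ := abs_lt.1 hw
  exact ((differentiableAt_Gamma_of_re_pos (z := a + I * w) (by simpa using hupper)).comp
    (f := fun w ↦ a + I * w) w (by fun_prop)).mul
    ((differentiableAt_Gamma_of_re_pos (z := a - I * w) (by simp; linarith)).comp
    (f := fun w ↦ a - I * w) w (by fun_prop))

theorem differentiableAt_gammaPair_left {a : ℂ} (ha : 0 < a.re) (u : ℝ) :
    DifferentiableAt ℂ (fun a ↦ gammaPair a u) a :=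
  ((differentiableAt_Gamma_of_re_pos (z := a + I * u) (by simpa using ha)).comp
    (f := fun a ↦ a + I * u) a (by fun_prop)).mul
    ((differentiableAt_Gamma_of_re_pos (z := a - I * u) (by simpa using ha)).comp
    (f := fun a ↦ a - I * u) a (by fun_prop))

theorem isBigO_gammaPair {a : ℂ} {r : ℝ} (ha : r < a.re) :
    gammaPair a =O[𝓟 (im ⁻¹' Icc (-r) r)] fun w ↦ Real.exp (-(3 * |w.re|)) :=
  isBigO_Gamma_add_mul_Gamma_sub ha ha

theorem isBigO_gammaPair_ofReal {a : ℂ} (ha : 0 < a.re) :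
    (fun u : ℝ ↦ gammaPair a u) =O[⊤] fun u ↦ Real.exp (-(3 * ‖u‖)) :=
  isBigO_Gamma_add_mul_Gamma_sub_ofReal ha ha

theorem exists_norm_gammaPair_le {δ : ℝ} (hδ : 0 < δ) (M : ℝ) :
    ∃ C, ∀ a : ℂ, a.re ∈ Icc δ M → ∀ u : ℝ, ‖gammaPair a u‖ ≤ C := by
  obtain ⟨C, hC⟩ := isBigO_principal.1 (isBigO_Gamma hδ M le_rfl Real.pi_div_two_pos)
  have hC (z : ℂ) (hz : z.re ∈ Icc δ M) : ‖Gamma z‖ ≤ C := by simpa using hC z hz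
  refine ⟨C * C, fun a ha u ↦ ?_⟩
  rw [gammaPair, norm_mul]
  exact mul_le_mul (hC _ (by simpa using ha)) (hC _ (by simpa using ha)) (norm_nonneg _)
    ((norm_nonneg _).trans (hC a ha))

theorem gammaPair_add_one_half_sub {a : ℂ} (ha : 0 < a.re) (u : ℝ) :
    gammaPair (a + 1 / 2) (u + (-(1 / 2) : ℝ) * I) = (a + I * u) * gammaPair a u := by
  have hne : a + I * u ≠ 0 := ne_zero_of_re_pos (by simpa using ha)
  rw [gammaPair, gammaPair, ← mul_assoc, ← Gamma_add_one _ hne]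
  congr 2
  · push_cast; linear_combination (-(1 / 2) : ℂ) * I_sq
  · push_cast; linear_combination (1 / 2 : ℂ) * I_sq

theorem gammaPair_neg (a w : ℂ) : gammaPair a (-w) = gammaPair a w := by
  rw [gammaPair, gammaPair, mul_neg, sub_neg_eq_add, ← sub_eq_add_neg, mul_comm]

theorem gammaPair_add_one_half_add {a : ℂ} (ha : 0 < a.re) (u : ℝ) :
    gammaPair (a + 1 / 2) (u + (1 / 2 : ℝ) * I) = (a - I * u) * gammaPair a u := by
  have h := gammaPair_add_one_half_sub ha (-u)
  rw [ofReal_neg, gammaPair_neg, mul_neg, ← sub_eq_add_neg] at h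
  rw [← h, ← gammaPair_neg]
  congr 1
  push_cast
  ring

theorem gammaPair_add_one {a : ℂ} (ha : 0 < a.re) (u : ℝ) :
    gammaPair (a + 1) u = (a ^ 2 + u ^ 2) * gammaPair a u := by
  have hplus : a + I * u ≠ 0 := ne_zero_of_re_pos (by simpa using ha)
  have hminus : a - I * u ≠ 0 := ne_zero_of_re_pos (by simpa using ha)
  rw [gammaPair, gammaPair, add_right_comm, add_sub_right_comm, Gamma_add_one _ hplus,
    Gamma_add_one _ hminus]
  linear_combination -(u ^ 2 * Gamma (a + I * u) * Gamma (a - I * u)) * I_sq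

theorem integrable_gammaPair_mul_gammaPair {a b : ℂ} (ha : 0 < a.re) (hb : 0 < b.re) :
    Integrable fun u : ℝ ↦ gammaPair a u * gammaPair b u := by
  refine integrable_of_isBigO_exp_neg_norm ((continuous_gammaPair ha).mul (continuous_gammaPair hb))
    (c := 6) (by norm_num)
    (((isBigO_gammaPair_ofReal ha).mul (isBigO_gammaPair_ofReal hb)).congr_right fun u ↦ ?_)
  rw [← Real.exp_add]
  ring_nf

theorem integral_gammaPair_mul_gammaPair {a b : ℂ} (ha : 0 < a.re) (hb : 0 < b.re) :
    ∫ u : ℝ, gammaPair a u * gammaPair b u = 2 * Real.pi *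
      (Gamma (2 * a) * Gamma (a + b) ^ 2 * Gamma (2 * b) / Gamma (2 * (a + b))) := by
  have hbarnes := integral_barnes_first ha hb ha hb
  rw [← two_mul, ← two_mul, add_assoc, ← two_mul, add_comm b a] at hbarnes
  rw [sq, ← mul_assoc (Gamma (2 * a)), ← hbarnes]
  congr 1 with u
  simp only [gammaPair]
  ring

end GammaPair

section Wilson

/-- The de Branges-Wilson weight `∏ Γ(b ± iu) / Γ(± 2iu)` with the parameter `a` left out, so that
the integral can be studied as a function of `a`. -/
noncomputable def wilsonWeight (b c d : ℂ) (u : ℝ) : ℂ :=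
  gammaPair b u * gammaPair c u * gammaPair d u *
    ((Gamma (2 * I * u))⁻¹ * (Gamma (-(2 * I * u)))⁻¹)

/-- The de Branges-Wilson integral over the whole real line. -/
noncomputable def wilsonIntegral (a b c d : ℂ) : ℂ :=
  ∫ u : ℝ, gammaPair a u * wilsonWeight b c d u

/-- The ratio of Gamma products that, up to the factor `4π`, evaluates `wilsonIntegral`. -/
noncomputable def wilsonProduct (a b c d : ℂ) : ℂ :=
  Gamma (a + b) * Gamma (a + c) * Gamma (a + d) * Gamma (b + c) * Gamma (b + d) * Gamma (c + d) /
    Gamma (a + b + c + d)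

theorem continuous_wilsonWeight {b c d : ℂ} (hb : 0 < b.re) (hc : 0 < c.re) (hd : 0 < d.re) :
    Continuous (wilsonWeight b c d) :=
  (((continuous_gammaPair hb).mul (continuous_gammaPair hc)).mul (continuous_gammaPair hd)).mul
    ((differentiable_one_div_Gamma.continuous.comp (g := fun z ↦ (Gamma z)⁻¹) (by fun_prop)).mul
      (differentiable_one_div_Gamma.continuous.comp (g := fun z ↦ (Gamma z)⁻¹) (by fun_prop)))

theorem isBigO_wilsonWeight {b c d : ℂ} (hb : 0 < b.re) (hc : 0 < c.re) (hd : 0 < d.re) :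
    wilsonWeight b c d =O[⊤] fun u ↦ Real.exp (-(1 * ‖u‖)) := by
  have hκ : Real.pi / 2 < 2 := by linarith [Real.pi_lt_four]
  have hplus := isBigO_inv_Gamma_comp (S := univ) (g := fun u : ℝ ↦ 2 * I * u)
    (h := fun u ↦ 2 * ‖u‖) (m := 0) (M := 0) (K := 0) hκ (by simp) (by simp [abs_mul])
  have hminus := isBigO_inv_Gamma_comp (S := univ) (g := fun u : ℝ ↦ -(2 * I * u))
    (h := fun u ↦ 2 * ‖u‖) (m := 0) (M := 0) (K := 0) hκ (by simp) (by simp [abs_mul])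
  rw [principal_univ] at hplus hminus
  refine ((((isBigO_gammaPair_ofReal hb).mul (isBigO_gammaPair_ofReal hc)).mul
    (isBigO_gammaPair_ofReal hd)).mul (hplus.mul hminus)).congr_right fun u ↦ ?_
  simp only [← Real.exp_add]
  ring_nf

theorem integrable_wilsonWeight {b c d : ℂ} (hb : 0 < b.re) (hc : 0 < c.re) (hd : 0 < d.re) :
    Integrable (wilsonWeight b c d) :=
  integrable_of_isBigO_exp_neg_norm (continuous_wilsonWeight hb hc hd) one_pos
    (isBigO_wilsonWeight hb hc hd)

theorem integrable_gammaPair_mul_wilsonWeight {a b c d : ℂ} (ha : 0 < a.re) (hb : 0 < b.re)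
    (hc : 0 < c.re) (hd : 0 < d.re) :
    Integrable fun u : ℝ ↦ gammaPair a u * wilsonWeight b c d u := by
  refine integrable_of_isBigO_exp_neg_norm
    ((continuous_gammaPair ha).mul (continuous_wilsonWeight hb hc hd)) four_pos
    (((isBigO_gammaPair_ofReal ha).mul (isBigO_wilsonWeight hb hc hd)).congr_right fun u ↦ ?_)
  rw [← Real.exp_add]
  ring_nf

theorem wilsonIntegral_swap (a b c d : ℂ) : wilsonIntegral a b c d = wilsonIntegral b a c d := by
  simp only [wilsonIntegral, wilsonWeight]
  congr 1 with u
  ring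

theorem wilsonProduct_swap (a b c d : ℂ) : wilsonProduct a b c d = wilsonProduct b a c d := by
  rw [wilsonProduct, wilsonProduct, add_comm b a]
  ring

end Wilson

section WilsonRecurrence

theorem inv_Gamma_mul_inv_Gamma_neg (z : ℂ) :
    (Gamma z)⁻¹ * (Gamma (-z))⁻¹ = -(z * sin (Real.pi * z)) / Real.pi := by
  rcases eq_or_ne z 0 with rfl | hz
  · simp
  have hreflection := Gamma_mul_Gamma_one_sub z
  rw [sub_eq_neg_add, Gamma_add_one _ (neg_ne_zero.2 hz)] at hreflection
  have hprod : Gamma z * Gamma (-z) = -(Real.pi / (z * sin (Real.pi * z))) := by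
    rw [mul_comm z, ← div_div, ← hreflection]
    field_simp
  rw [← mul_inv, hprod, inv_neg, inv_div, neg_div]

/-- The holomorphic function of which the three-term identity between the integrands of
`wilsonIntegral (a + 1) b c d` and `wilsonIntegral a b c d` is the difference across the strip
`|Im w| ≤ 1 / 2`. -/
noncomputable def wilsonContourKernel (a b c d w : ℂ) : ℂ :=
  sin (2 * Real.pi * (I * w)) * (gammaPair (a + 1 / 2) w * gammaPair (b + 1 / 2) w *
    gammaPair (c + 1 / 2) w * gammaPair (d + 1 / 2) w)

theorem differentiableAt_wilsonContourKernel {a b c d w : ℂ} (ha : 0 < a.re) (hb : 0 < b.re)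
    (hc : 0 < c.re) (hd : 0 < d.re) (hw : |w.im| ≤ 1 / 2) :
    DifferentiableAt ℂ (wilsonContourKernel a b c d) w := by
  have hpair {e : ℂ} (he : 0 < e.re) : DifferentiableAt ℂ (gammaPair (e + 1 / 2)) w :=
    differentiableAt_gammaPair (hw.trans_lt (by simpa using he))
  exact (by fun_prop : DifferentiableAt ℂ (fun w ↦ sin (2 * Real.pi * (I * w))) w).mul
    ((((hpair ha).mul (hpair hb)).mul (hpair hc)).mul (hpair hd))

theorem isBigO_wilsonContourKernel {a b c d : ℂ} (ha : 0 < a.re) (hb : 0 < b.re)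
    (hc : 0 < c.re) (hd : 0 < d.re) :
    wilsonContourKernel a b c d =O[𝓟 (im ⁻¹' Icc (-(1 / 2)) (1 / 2))]
      fun w ↦ Real.exp (-(4 * |w.re|)) := by
  have hpair {e : ℂ} (he : 0 < e.re) := isBigO_gammaPair (a := e + 1 / 2) (r := 1 / 2)
    (by simpa using he)
  have hsin : (fun w ↦ sin (2 * Real.pi * (I * w)))
      =O[𝓟 (im ⁻¹' Icc (-(1 / 2)) (1 / 2))] fun w ↦ Real.exp (8 * |w.re|) := by
    refine .of_bound 1 (.of_forall fun w ↦ ?_)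
    rw [one_mul, Real.norm_of_nonneg (Real.exp_pos _).le]
    refine (norm_sin_le_exp_abs_im _).trans (Real.exp_le_exp.2 ?_)
    rw [show (2 * Real.pi * (I * w)).im = 2 * Real.pi * w.re by simp, abs_mul,
      abs_of_pos Real.two_pi_pos]
    gcongr
    linarith [Real.pi_lt_four]
  refine (hsin.mul ((((hpair ha).mul (hpair hb)).mul (hpair hc)).mul (hpair hd))).congr_right
    fun w ↦ ?_
  simp only [← Real.exp_add]
  ring_nf

theorem sub_eq_wilsonContourKernel_sub {a b c d : ℂ} (ha : 0 < a.re) (hb : 0 < b.re)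
    (hc : 0 < c.re) (hd : 0 < d.re) (u : ℝ) :
    (a + b + c + d) * (gammaPair (a + 1) u * wilsonWeight b c d u) -
      (a + b) * (a + c) * (a + d) * (gammaPair a u * wilsonWeight b c d u) =
    (Real.pi : ℂ)⁻¹ * (wilsonContourKernel a b c d (u + (1 / 2 : ℝ) * I) -
      wilsonContourKernel a b c d (u + (-(1 / 2) : ℝ) * I)) := by
  have hlower : sin (2 * Real.pi * (I * (u + (-(1 / 2) : ℝ) * I))) =
      -sin (Real.pi * (2 * I * u)) := by
    rw [← Complex.sin_add_pi]
    congr 1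
    push_cast
    linear_combination (-Real.pi : ℂ) * I_sq
  have hupper : sin (2 * Real.pi * (I * (u + (1 / 2 : ℝ) * I))) =
      -sin (Real.pi * (2 * I * u)) := by
    rw [← Complex.sin_sub_pi]
    congr 1
    push_cast
    linear_combination (Real.pi : ℂ) * I_sq
  have hsq : (u : ℂ) ^ 2 = -(I * u) ^ 2 := by rw [mul_pow, I_sq, neg_one_mul, neg_neg]
  simp only [wilsonContourKernel, hlower, hupper, gammaPair_add_one_half_sub ha,
    gammaPair_add_one_half_sub hb, gammaPair_add_one_half_sub hc, gammaPair_add_one_half_sub hd,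
    gammaPair_add_one_half_add ha, gammaPair_add_one_half_add hb, gammaPair_add_one_half_add hc,
    gammaPair_add_one_half_add hd, gammaPair_add_one ha, wilsonWeight,
    inv_Gamma_mul_inv_Gamma_neg, hsq]
  ring

theorem wilsonIntegral_add_one {a b c d : ℂ} (ha : 0 < a.re) (hb : 0 < b.re) (hc : 0 < c.re)
    (hd : 0 < d.re) : (a + b + c + d) * wilsonIntegral (a + 1) b c d =
      (a + b) * (a + c) * (a + d) * wilsonIntegral a b c d := by
  have hdiff (w : ℂ) (hw : w.im ∈ Icc (-(1 / 2) : ℝ) (1 / 2)) :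
      DifferentiableAt ℂ (wilsonContourKernel a b c d) w :=
    differentiableAt_wilsonContourKernel ha hb hc hd (abs_le.2 hw)
  have hO := isBigO_wilsonContourKernel ha hb hc hd
  have hle : (-(1 / 2) : ℝ) ≤ 1 / 2 := by norm_num
  have hshift := integral_add_mul_I_eq_of_isBigO_exp_neg (f := wilsonContourKernel a b c d)
    (a := -(1 / 2)) (b := 1 / 2) four_pos
    (by rwa [uIcc_of_le hle]) (by rwa [uIcc_of_le hle])
  have hint {y : ℝ} (hy : y ∈ Icc (-(1 / 2) : ℝ) (1 / 2)) :
      Integrable fun u : ℝ ↦ wilsonContourKernel a b c d (u + y * I) :=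
    integrable_add_mul_I_of_isBigO_exp_neg four_pos
      (fun w hw ↦ (hdiff w (mem_singleton_iff.1 hw ▸ hy)).continuousAt.continuousWithinAt)
      (hO.mono (principal_mono.2 (preimage_mono (singleton_subset_iff.2 hy))))
  rw [← sub_eq_zero, wilsonIntegral, wilsonIntegral, ← integral_const_mul, ← integral_const_mul,
    ← integral_sub
      ((integrable_gammaPair_mul_wilsonWeight (by simpa using by positivity) hb hc hd).const_mul _)
      ((integrable_gammaPair_mul_wilsonWeight ha hb hc hd).const_mul _)]
  simp_rw [sub_eq_wilsonContourKernel_sub ha hb hc hd]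
  rw [integral_const_mul, integral_sub (hint (right_mem_Icc.2 hle)) (hint (left_mem_Icc.2 hle)),
    hshift, sub_self, mul_zero]

theorem wilsonProduct_ne_zero {a b c d : ℂ} (ha : 0 < a.re) (hb : 0 < b.re) (hc : 0 < c.re)
    (hd : 0 < d.re) : wilsonProduct a b c d ≠ 0 := by
  have hpair {z w : ℂ} (hz : 0 < z.re) (hw : 0 < w.re) : Gamma (z + w) ≠ 0 :=
    Gamma_ne_zero_of_re_pos (by simpa using add_pos hz hw)
  exact div_ne_zero (by simp [*]) (hpair (by simpa using by positivity) hd)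

theorem wilsonProduct_add_one {a b c d : ℂ} (ha : 0 < a.re) (hb : 0 < b.re) (hc : 0 < c.re)
    (hd : 0 < d.re) : (a + b + c + d) * wilsonProduct (a + 1) b c d =
      (a + b) * (a + c) * (a + d) * wilsonProduct a b c d := by
  have hsum : 0 < (a + b + c + d).re := by simp only [add_re]; positivity
  have hsum_ne := ne_zero_of_re_pos hsum
  have hGamma_ne := Gamma_ne_zero_of_re_pos hsum
  simp only [wilsonProduct, add_right_comm _ (1 : ℂ)]
  rw [Gamma_add_one (a + b) (ne_zero_of_re_pos (by simpa using add_pos ha hb)),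
    Gamma_add_one (a + c) (ne_zero_of_re_pos (by simpa using add_pos ha hc)),
    Gamma_add_one (a + d) (ne_zero_of_re_pos (by simpa using add_pos ha hd)),
    Gamma_add_one _ hsum_ne]
  field_simp

end WilsonRecurrence

section WilsonEvaluation

theorem isBigO_wilsonIntegral_one {b c d : ℂ} (hb : 0 < b.re) (hc : 0 < c.re) (hd : 0 < d.re)
    {δ : ℝ} (hδ : 0 < δ) (M : ℝ) :
    (fun a ↦ wilsonIntegral a b c d) =O[𝓟 (re ⁻¹' Icc δ M)] fun _ ↦ (1 : ℝ) := by
  obtain ⟨C, hC⟩ := exists_norm_gammaPair_le hδ M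
  have hweight := integrable_wilsonWeight hb hc hd
  refine isBigO_principal.2 ⟨∫ u, C * ‖wilsonWeight b c d u‖, fun a ha ↦ ?_⟩
  rw [norm_one, mul_one]
  refine norm_integral_le_of_norm_le (hweight.norm.const_mul C) (.of_forall fun u ↦ ?_)
  rw [norm_mul]
  gcongr
  exact hC a ha u

theorem differentiableOn_wilsonIntegral {b c d : ℂ} (hb : 0 < b.re) (hc : 0 < c.re)
    (hd : 0 < d.re) : DifferentiableOn ℂ (fun a ↦ wilsonIntegral a b c d) {a | 0 < a.re} := by
  intro a (ha : 0 < a.re)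
  set U : Set ℂ := re ⁻¹' Ioo (a.re / 2) (a.re + 1)
  have hU : IsOpen U := isOpen_Ioo.preimage continuous_re
  have hpos {z : ℂ} (hz : z ∈ U) : 0 < z.re := (half_pos ha).trans hz.1
  obtain ⟨C, hC⟩ := exists_norm_gammaPair_le (half_pos ha) (a.re + 1)
  have hdiff : DifferentiableOn ℂ (fun a ↦ wilsonIntegral a b c d) U := by
    refine differentiableOn_integral_of_norm_le (μ := volume) hU
      (F := fun z (u : ℝ) ↦ gammaPair z u * wilsonWeight b c d u)
      (.of_forall fun u z hz ↦ ((differentiableAt_gammaPair_left (hpos hz) u).mul_const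
        _).differentiableWithinAt)
      (fun z hz ↦ ((continuous_gammaPair (hpos hz)).mul
        (continuous_wilsonWeight hb hc hd)).aestronglyMeasurable)
      (.of_forall fun u z hz ↦ ?_) ((integrable_wilsonWeight hb hc hd).norm.const_mul C)
    rw [norm_mul]
    gcongr
    exact hC z (Ioo_subset_Icc_self hz) u
  exact (hdiff.differentiableAt (hU.mem_nhds ⟨by linarith, by linarith⟩)).differentiableWithinAt

theorem inv_wilsonProduct (a b c d : ℂ) :
    (wilsonProduct a b c d)⁻¹ =
      (Gamma (a + b))⁻¹ * (Gamma (a + c))⁻¹ * (Gamma (a + d))⁻¹ * Gamma (a + b + c + d) *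
        (Gamma (b + c) * Gamma (b + d) * Gamma (c + d))⁻¹ := by
  rw [wilsonProduct, inv_div, div_eq_mul_inv]
  simp only [mul_inv]
  ring

theorem differentiableAt_inv_wilsonProduct {a b c d : ℂ} (h : 0 < (a + b + c + d).re) :
    DifferentiableAt ℂ (fun a ↦ (wilsonProduct a b c d)⁻¹) a := by
  have hinv (e : ℂ) : DifferentiableAt ℂ (fun a ↦ (Gamma (a + e))⁻¹) a :=
    differentiable_one_div_Gamma.differentiableAt.comp a (by fun_prop)
  simp only [inv_wilsonProduct]
  exact ((((hinv b).mul (hinv c)).mul (hinv d)).mul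
    ((differentiableAt_Gamma_of_re_pos h).comp (f := fun a ↦ a + b + c + d) a
      (by fun_prop))).mul_const _

theorem isBigO_inv_wilsonProduct {b c d : ℂ} {m : ℝ} (h : 0 < m + (b + c + d).re) (M : ℝ) :
    (fun a ↦ (wilsonProduct a b c d)⁻¹) =O[𝓟 (re ⁻¹' Icc m M)]
      fun a ↦ Real.exp (6 * |a.im|) := by
  have hinv (e : ℂ) := isBigO_inv_Gamma_comp (S := re ⁻¹' Icc m M) (g := fun a ↦ a + e)
    (h := fun a ↦ |a.im|) (m := m + e.re) (M := M + e.re) (K := |e.im|)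
    (κ := 2) (by linarith [Real.pi_lt_four])
    (fun a ha ↦ ⟨add_le_add_left ha.1 _, add_le_add_left ha.2 _⟩) fun a _ ↦ abs_add_le _ _
  have hGamma := isBigO_Gamma_comp (S := re ⁻¹' Icc m M) (g := fun a ↦ a + (b + c + d))
    (h := fun a ↦ |a.im|) (M := M + (b + c + d).re) (K := |(b + c + d).im|) h le_rfl
    Real.pi_div_two_pos (fun a ha ↦ ⟨add_le_add_left ha.1 _, add_le_add_left ha.2 _⟩)
    fun a _ ↦ by
      simpa only [abs_neg, sub_neg_eq_add, sub_le_iff_le_add, add_im] using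
        abs_sub_abs_le_abs_sub a.im (-(b + c + d).im)
  refine ((((hinv b).mul (hinv c)).mul (hinv d)).mul hGamma |>.mul
    (isBigO_const_const (Gamma (b + c) * Gamma (b + d) * Gamma (c + d))⁻¹ one_ne_zero _)).congr
    (fun a ↦ ?_) fun a ↦ ?_
  · simp only [inv_wilsonProduct, ← add_assoc]
  · simp only [← Real.exp_add, mul_one]
    ring_nf

theorem wilsonIntegral_div_wilsonProduct_eq {a a' b c d : ℂ} (ha : 0 < a.re) (ha' : 0 < a'.re)
    (hb : 0 < b.re) (hc : 0 < c.re) (hd : 0 < d.re) :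
    wilsonIntegral a b c d / wilsonProduct a b c d =
      wilsonIntegral a' b c d / wilsonProduct a' b c d := by
  have hsum {z : ℂ} (hz : 0 < z.re) : 0 < (z + b + c + d).re := by
    simp only [add_re]
    positivity
  have hbcd : 0 < 1 + (b + c + d).re := by
    simp only [add_re]
    positivity
  refine apply_eq_apply_of_periodic_of_isBigO_strip (c := 6) (by linarith [Real.pi_gt_d2])
    (F := fun a ↦ wilsonIntegral a b c d / wilsonProduct a b c d) ?_ (fun z hz ↦ ?_) ?_ ha ha'
  · simp only [div_eq_mul_inv]
    exact (differentiableOn_wilsonIntegral hb hc hd).mul fun z hz ↦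
      (differentiableAt_inv_wilsonProduct (hsum hz)).differentiableWithinAt
  · have hsum_ne : z + b + c + d ≠ 0 := ne_zero_of_re_pos (hsum hz)
    have hz' : 0 < (z + 1).re := by simpa using by positivity
    rw [div_eq_div_iff (wilsonProduct_ne_zero hz' hb hc hd) (wilsonProduct_ne_zero hz hb hc hd)]
    refine mul_left_cancel₀ hsum_ne ?_
    linear_combination wilsonProduct z b c d * wilsonIntegral_add_one hz hb hc hd -
      wilsonIntegral z b c d * wilsonProduct_add_one hz hb hc hd
  · simpa only [div_eq_mul_inv, one_mul] using
      (isBigO_wilsonIntegral_one hb hc hd one_pos 2).mul (isBigO_inv_wilsonProduct hbcd 2)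

theorem Gamma_add_half_mul_Gamma_add_one {z : ℂ} (hz : z ≠ 0) :
    Gamma (z + 1 / 2) * Gamma (z + 1) =
      2 * z * Gamma (2 * z) * 2 ^ (-(2 * z)) * (Real.sqrt Real.pi : ℂ) := by
  have hduplication := Gamma_mul_Gamma_add_half z
  rw [sub_eq_add_neg, cpow_add _ _ two_ne_zero, cpow_one] at hduplication
  rw [Gamma_add_one z hz]
  linear_combination z * hduplication

theorem gammaPair_one_half_mul_gammaPair_one (u : ℝ) :
    gammaPair (1 / 2) u * gammaPair 1 u * ((Gamma (2 * I * u))⁻¹ * (Gamma (-(2 * I * u)))⁻¹) =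
      4 * Real.pi * u ^ 2 := by
  rcases eq_or_ne u 0 with rfl | hu
  · simp
  have hne : I * (u : ℂ) ≠ 0 := by simpa using hu
  have hGamma {z : ℂ} (hz : z ≠ 0) (hre : z.re = 0) : Gamma z ≠ 0 := fun h ↦
    Gamma_ne_zero_of_re_pos (s := z + 1) (by simp [hre]) (by rw [Gamma_add_one z hz, h, mul_zero])
  have hplus := hGamma (z := 2 * (I * u)) (by simpa using hu) (by simp)
  have hminus := hGamma (z := -(2 * (I * u))) (by simpa using hu) (by simp)
  have hsqrt : (Real.sqrt Real.pi : ℂ) * Real.sqrt Real.pi = Real.pi := by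
    rw [← ofReal_mul, Real.mul_self_sqrt Real.pi_pos.le]
  have hcpow : (2 : ℂ) ^ (-(2 * (I * u))) * 2 ^ (2 * (I * u)) = 1 := by
    rw [← cpow_add _ _ two_ne_zero, neg_add_cancel, cpow_zero]
  have hdup_plus := Gamma_add_half_mul_Gamma_add_one hne
  have hdup_minus := Gamma_add_half_mul_Gamma_add_one (neg_ne_zero.2 hne)
  rw [mul_neg, neg_neg] at hdup_minus
  rw [mul_assoc 2 I, ← mul_inv, ← div_eq_mul_inv, div_eq_iff (mul_ne_zero hplus hminus)]
  calc gammaPair (1 / 2) u * gammaPair 1 u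
      = (Gamma (I * u + 1 / 2) * Gamma (I * u + 1)) *
          (Gamma (-(I * u) + 1 / 2) * Gamma (-(I * u) + 1)) := by
        simp only [gammaPair, sub_eq_add_neg, add_comm _ (I * (u : ℂ)), add_comm _ (-(I * (u : ℂ)))]
        ring
    _ = 4 * Real.pi * u ^ 2 * (Gamma (2 * (I * u)) * Gamma (-(2 * (I * u)))) := by
        rw [hdup_plus, hdup_minus]
        linear_combination -4 * Gamma (2 * (I * u)) * Gamma (-(2 * (I * u))) *
          ((I * u) ^ 2 * 2 ^ (-(2 * (I * u))) * 2 ^ (2 * (I * u)) * hsqrt +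
            (I * u) ^ 2 * Real.pi * hcpow + Real.pi * u ^ 2 * I_sq)

theorem wilsonIntegral_one_half_one {c d : ℂ} (hc : 0 < c.re) (hd : 0 < d.re) :
    wilsonIntegral (1 / 2) 1 c d = 8 * Real.pi ^ 2 * (c * d / (2 * (c + d) + 1)) *
      (Gamma (2 * c) * Gamma (c + d) ^ 2 * Gamma (2 * d) / Gamma (2 * (c + d))) := by
  have hc1 : 0 < (c + 1).re := by simpa using by positivity
  have hS : 0 < (c + d).re := by simpa using add_pos hc hd
  have hS2 : 0 < (2 * (c + d)).re := by simpa using add_pos hc hd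
  have hintegrand (u : ℝ) : gammaPair (1 / 2) u * wilsonWeight 1 c d u =
      4 * Real.pi * (gammaPair (c + 1) u * gammaPair d u -
        c ^ 2 * (gammaPair c u * gammaPair d u)) := by
    rw [gammaPair_add_one hc, wilsonWeight]
    linear_combination gammaPair c u * gammaPair d u * gammaPair_one_half_mul_gammaPair_one u
  have hGamma_c : Gamma (2 * (c + 1)) = (2 * c + 1) * (2 * c * Gamma (2 * c)) := by
    rw [← Gamma_add_one _ (ne_zero_of_re_pos (by simpa using hc)),
      ← Gamma_add_one _ (ne_zero_of_re_pos (by simpa using by positivity))]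
    ring_nf
  have hGamma_S : Gamma (2 * (c + 1 + d)) =
      (2 * (c + d) + 1) * (2 * (c + d) * Gamma (2 * (c + d))) := by
    rw [← Gamma_add_one _ (ne_zero_of_re_pos hS2),
      ← Gamma_add_one _ (ne_zero_of_re_pos (by simpa using by positivity))]
    ring_nf
  simp only [wilsonIntegral, hintegrand]
  rw [integral_const_mul, integral_sub (integrable_gammaPair_mul_gammaPair hc1 hd)
    ((integrable_gammaPair_mul_gammaPair hc hd).const_mul _), integral_const_mul,
    integral_gammaPair_mul_gammaPair hc1 hd, integral_gammaPair_mul_gammaPair hc hd, hGamma_c,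
    hGamma_S, add_right_comm c, Gamma_add_one _ (ne_zero_of_re_pos hS)]
  have := ne_zero_of_re_pos hS
  have := Gamma_ne_zero_of_re_pos hS2
  have : 2 * (c + d) + 1 ≠ 0 := ne_zero_of_re_pos (by simpa using by positivity)
  field_simp
  ring

theorem wilsonProduct_one_half_one {c d : ℂ} (hc : 0 < c.re) (hd : 0 < d.re) :
    wilsonProduct (1 / 2) 1 c d = 2 * Real.pi * (c * d / (2 * (c + d) + 1)) *
      (Gamma (2 * c) * Gamma (c + d) ^ 2 * Gamma (2 * d) / Gamma (2 * (c + d))) := by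
  have hS : 0 < (c + d).re := by simpa using add_pos hc hd
  have hthree_halves : Gamma (1 / 2 + 1) = Real.sqrt Real.pi / 2 := by
    rw [Gamma_add_one _ (by norm_num), show (1 / 2 : ℂ) = (1 / 2 : ℝ) by norm_num, Gamma_ofReal,
      Real.Gamma_one_half_eq]
    push_cast
    ring
  have hsqrt : (Real.sqrt Real.pi : ℂ) ^ 2 = Real.pi := by
    rw [← ofReal_pow, Real.sq_sqrt Real.pi_pos.le]
  have hdup_S : Gamma (c + d + 1 / 2) = 2 * Gamma (2 * (c + d)) * (2 ^ (-(2 * c)) *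
      2 ^ (-(2 * d))) * Real.sqrt Real.pi / Gamma (c + d) := by
    have hdup := Gamma_add_half_mul_Gamma_add_one (ne_zero_of_re_pos hS)
    rw [mul_add, neg_add, cpow_add _ _ two_ne_zero, Gamma_add_one _ (ne_zero_of_re_pos hS)] at hdup
    rw [eq_div_iff (Gamma_ne_zero_of_re_pos hS), mul_add]
    exact mul_left_cancel₀ (ne_zero_of_re_pos hS) (by linear_combination hdup)
  have hdenom : Gamma (1 / 2 + 1 + c + d) = (c + d + 1 / 2) * Gamma (c + d + 1 / 2) := by
    rw [← Gamma_add_one _ (ne_zero_of_re_pos (by simpa using by positivity))]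
    ring_nf
  have hnum : wilsonProduct (1 / 2) 1 c d = Gamma (1 / 2 + 1) *
      (Gamma (c + 1 / 2) * Gamma (c + 1)) * (Gamma (d + 1 / 2) * Gamma (d + 1)) * Gamma (c + d) /
        Gamma (1 / 2 + 1 + c + d) := by
    rw [wilsonProduct, add_comm _ c, add_comm _ d, add_comm 1 c, add_comm 1 d]
    ring
  rw [hnum, hdenom, hdup_S, hthree_halves, Gamma_add_half_mul_Gamma_add_one (ne_zero_of_re_pos hc),
    Gamma_add_half_mul_Gamma_add_one (ne_zero_of_re_pos hd)]
  have := Gamma_ne_zero_of_re_pos hS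
  have : 2 * (c + d) + 1 ≠ 0 := ne_zero_of_re_pos (by simpa using by positivity)
  field_simp
  rw [hsqrt]
  ring

theorem wilsonIntegral_eq {a b c d : ℂ} (ha : 0 < a.re) (hb : 0 < b.re) (hc : 0 < c.re)
    (hd : 0 < d.re) : wilsonIntegral a b c d = 4 * Real.pi * wilsonProduct a b c d := by
  have hhalf : 0 < (1 / 2 : ℂ).re := by norm_num
  have hone : 0 < (1 : ℂ).re := by norm_num
  rw [← div_eq_iff (wilsonProduct_ne_zero ha hb hc hd),
    wilsonIntegral_div_wilsonProduct_eq ha hone hb hc hd, wilsonIntegral_swap, wilsonProduct_swap,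
    wilsonIntegral_div_wilsonProduct_eq hb hhalf hone hc hd,
    div_eq_iff (wilsonProduct_ne_zero hhalf hone hc hd), wilsonIntegral_one_half_one hc hd,
    wilsonProduct_one_half_one hc hd]
  ring

end WilsonEvaluation

section DoubleContourShift

theorem norm_le_norm_fst_add_norm_snd {E F : Type*} [SeminormedAddGroup E] [SeminormedAddGroup F]
    (p : E × F) : ‖p‖ ≤ ‖p.1‖ + ‖p.2‖ :=
  max_le_add_of_nonneg (norm_nonneg p.1) (norm_nonneg p.2)

variable {E : Type*} [NormedAddCommGroup E] {f : ℂ × ℂ → E} {c : ℝ}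

theorem integrable_prod_add_mul_I_of_isBigO_exp_neg {a b : ℝ} (hc : 0 < c)
    (hf : ContinuousOn f ((im ⁻¹' {a}) ×ˢ (im ⁻¹' {b})))
    (hO : f =O[𝓟 ((im ⁻¹' {a}) ×ˢ (im ⁻¹' {b}))]
      fun p ↦ Real.exp (-(c * (|p.1.re| + |p.2.re|)))) :
    Integrable fun p : ℝ × ℝ ↦ f (p.1 + a * I, p.2 + b * I) := by
  have hline : ∀ p : ℝ × ℝ,
      ((p.1 + a * I, p.2 + b * I) : ℂ × ℂ) ∈ (im ⁻¹' {a}) ×ˢ (im ⁻¹' {b}) := by simp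
  refine integrable_of_isBigO_exp_neg_norm (hf.comp_continuous (by fun_prop) hline) hc ?_
  refine (hO.comp_tendsto (tendsto_principal.2 (Eventually.of_forall hline) : Tendsto _ ⊤ _)).trans
    (principal_univ (α := ℝ × ℝ) ▸ isBigO_exp_of_le 0 fun p _ ↦ ?_)
  simpa using mul_le_mul_of_nonneg_left (norm_le_norm_fst_add_norm_snd p) hc.le

variable [NormedSpace ℂ E] [CompleteSpace E]

theorem integral_prod_add_mul_I_of_isBigO_exp_neg {a b : ℝ} (hc : 0 < c)
    (hd : ∀ p ∈ (im ⁻¹' uIcc 0 a) ×ˢ (im ⁻¹' uIcc 0 b), DifferentiableAt ℂ f p)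
    (hO : f =O[𝓟 ((im ⁻¹' uIcc 0 a) ×ˢ (im ⁻¹' uIcc 0 b))]
      fun p ↦ Real.exp (-(c * (|p.1.re| + |p.2.re|)))) :
    ∫ p : ℝ × ℝ, f (p.1 + a * I, p.2 + b * I) = ∫ p : ℝ × ℝ, f (p.1, p.2) := by
  have hint {y z : ℝ} (hy : y ∈ uIcc 0 a) (hz : z ∈ uIcc 0 b) :
      Integrable fun p : ℝ × ℝ ↦ f (p.1 + y * I, p.2 + z * I) := by
    have hsub : (im ⁻¹' {y}) ×ˢ (im ⁻¹' {z}) ⊆ (im ⁻¹' uIcc 0 a) ×ˢ (im ⁻¹' uIcc 0 b) :=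
      prod_mono (preimage_mono (singleton_subset_iff.2 hy))
        (preimage_mono (singleton_subset_iff.2 hz))
    exact integrable_prod_add_mul_I_of_isBigO_exp_neg hc
      (fun p hp ↦ (hd p (hsub hp)).continuousAt.continuousWithinAt)
      (hO.mono (principal_mono.2 hsub))
  have hfst (w : ℝ) : ∫ t : ℝ, f (t + (0 : ℝ) * I, w + b * I) =
      ∫ t : ℝ, f (t + a * I, w + b * I) := by
    have hmem {t : ℂ} (ht : t.im ∈ uIcc 0 a) :
        (t, (w + b * I : ℂ)) ∈ (im ⁻¹' uIcc 0 a) ×ˢ (im ⁻¹' uIcc 0 b) := by simpa using ht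
    refine integral_add_mul_I_eq_of_isBigO_exp_neg (f := fun t ↦ f (t, w + b * I)) hc
      (fun t ht ↦ (hd _ (hmem ht)).comp t (f := fun t ↦ (t, (w + b * I : ℂ))) (by fun_prop)) ?_
    refine (hO.comp_tendsto (tendsto_principal_principal.2 fun t ↦ hmem)).trans
      (isBigO_exp_of_le 0 fun t _ ↦ ?_)
    nlinarith [abs_nonneg (w + b * I : ℂ).re]
  have hsnd (t : ℝ) : ∫ w : ℝ, f (t, w + (0 : ℝ) * I) = ∫ w : ℝ, f (t, w + b * I) := by
    have hmem {w : ℂ} (hw : w.im ∈ uIcc 0 b) :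
        ((t : ℂ), w) ∈ (im ⁻¹' uIcc 0 a) ×ˢ (im ⁻¹' uIcc 0 b) := by simpa using hw
    refine integral_add_mul_I_eq_of_isBigO_exp_neg (f := fun w ↦ f (t, w)) hc
      (fun w hw ↦ (hd _ (hmem hw)).comp w (f := fun w ↦ ((t : ℂ), w)) (by fun_prop)) ?_
    refine (hO.comp_tendsto (tendsto_principal_principal.2 fun w ↦ hmem)).trans
      (isBigO_exp_of_le 0 fun w _ ↦ ?_)
    nlinarith [abs_nonneg (t : ℂ).re]
  have hmixed := hint left_mem_uIcc (right_mem_uIcc (a := (0 : ℝ)) (b := b))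
  have hreal := hint left_mem_uIcc (left_mem_uIcc (a := (0 : ℝ)) (b := b))
  simp only [ofReal_zero, zero_mul, add_zero] at hfst hsnd hmixed hreal
  calc ∫ p : ℝ × ℝ, f (p.1 + a * I, p.2 + b * I)
      = ∫ w : ℝ, ∫ t : ℝ, f (t + a * I, w + b * I) :=
        integral_prod_symm _ (hint right_mem_uIcc right_mem_uIcc)
    _ = ∫ w : ℝ, ∫ t : ℝ, f (t, w + b * I) := by simp_rw [hfst]
    _ = ∫ t : ℝ, ∫ w : ℝ, f (t, w + b * I) := (integral_integral_swap hmixed).symm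
    _ = ∫ t : ℝ, ∫ w : ℝ, f (t, w) := by simp_rw [hsnd]
    _ = ∫ p : ℝ × ℝ, f (p.1, p.2) := (integral_prod _ hreal).symm

theorem integral_prod_add_eq_of_isBigO_exp_neg {α β : ℂ} (hc : 0 < c)
    (hd : ∀ p ∈ (im ⁻¹' uIcc 0 α.im) ×ˢ (im ⁻¹' uIcc 0 β.im), DifferentiableAt ℂ f p)
    (hO : f =O[𝓟 ((im ⁻¹' uIcc 0 α.im) ×ˢ (im ⁻¹' uIcc 0 β.im))]
      fun p ↦ Real.exp (-(c * (|p.1.re| + |p.2.re|)))) :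
    ∫ p : ℝ × ℝ, f (α + p.1, β + p.2) = ∫ p : ℝ × ℝ, f (p.1, p.2) := by
  rw [← integral_prod_add_mul_I_of_isBigO_exp_neg hc hd hO,
    ← integral_add_right_eq_self (fun p : ℝ × ℝ ↦ f (p.1 + α.im * I, p.2 + β.im * I))
      (α.re, β.re)]
  congr 1 with p
  congr 2 <;> apply Complex.ext <;> simp [add_comm]

end DoubleContourShift

section ChangeOfVariables

theorem measurePreserving_shear_sub :
    MeasurePreserving fun p : (ℝ × ℝ) × ℝ ↦ (p.2, p.1.1 - p.2, p.1.2 - p.2) := by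
  have hshear : MeasurePreserving (fun p : ℝ × (ℝ × ℝ) ↦ (p.1, p.2 - (p.1, p.1)))
      (volume.prod volume) (volume.prod volume) :=
    (MeasurePreserving.id volume).skew_product (g := fun (s : ℝ) (p : ℝ × ℝ) ↦ p - (s, s))
      (by unfold Function.uncurry; fun_prop)
      (.of_forall fun s ↦ (measurePreserving_sub_right volume ((s, s) : ℝ × ℝ)).map_eq)
  exact hshear.comp Measure.measurePreserving_swap

theorem measurePreserving_half_add_half_sub :
    MeasurePreserving fun p : ℝ × ℝ ↦ (p.1 / 2 + p.2, p.1 / 2 - p.2) := by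
  have hreflect : MeasurePreserving (fun p : ℝ × ℝ ↦ (p.1, p.1 / 2 - p.2))
      (volume.prod volume) (volume.prod volume) :=
    (MeasurePreserving.id volume).skew_product (g := fun (w : ℝ) (u : ℝ) ↦ w / 2 - u)
      (by unfold Function.uncurry; fun_prop)
      (.of_forall fun w ↦ (Measure.measurePreserving_sub_left volume (w / 2)).map_eq)
  have hshear : MeasurePreserving (fun p : ℝ × ℝ ↦ (p.1, p.2 - p.1))
      (volume.prod volume) (volume.prod volume) :=
    (MeasurePreserving.id volume).skew_product (g := fun (v : ℝ) (w : ℝ) ↦ w - v)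
      (by unfold Function.uncurry; fun_prop)
      (.of_forall fun v ↦ (measurePreserving_sub_right volume v).map_eq)
  change MeasurePreserving _ (volume.prod volume) (volume.prod volume)
  convert (Measure.measurePreserving_swap.comp hshear).comp
    (Measure.measurePreserving_swap.comp hreflect) using 1
  ext p
  · simp only [Function.comp_apply, Prod.fst_swap, Prod.snd_swap]
    ring
  · rfl

theorem integral_eq_integral_integral_of_measurePreserving {α β X E : Type*} [MeasurableSpace α]
    [MeasurableSpace β] [MeasurableSpace X] [NormedAddCommGroup E] [NormedSpace ℝ E]
    {μ : Measure α} {ν : Measure β} [SFinite μ] [SFinite ν] {ξ : Measure X} {φ : α × β → X}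
    (hφ : MeasurePreserving φ (μ.prod ν) ξ) {f : X → E} (hf : Integrable f ξ) :
    ∫ x, f x ∂ξ = ∫ a, ∫ b, f (φ (a, b)) ∂ν ∂μ := by
  rw [← hφ.map_eq, integral_map hφ.measurable.aemeasurable (hφ.map_eq.symm ▸ hf.1)]
  exact integral_prod _ ((hφ.integrable_comp hf.1).2 hf)

end ChangeOfVariables

section Integrands

variable {X : Type*} {g : X → ℂ}

theorem isBigO_cexp_one_of_re_le {S : Set X} {K : ℝ} (h : ∀ x ∈ S, (g x).re ≤ K) :
    (fun x ↦ exp (g x)) =O[𝓟 S] fun _ ↦ (1 : ℝ) :=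
  isBigO_principal.2 ⟨Real.exp K, fun x hx ↦ by simpa [norm_exp] using h x hx⟩

theorem isBigO_Gamma_comp_of_re_eq {h : X → ℝ} {δ K : ℝ} (hδ : 0 < δ)
    (hre : ∀ x, (g x).re = δ) (him : ∀ x, h x ≤ |(g x).im| + K) :
    (fun x ↦ Gamma (g x)) =O[⊤] fun x ↦ Real.exp (-(3 / 2 * h x)) := by
  have hκ : 3 / 2 < Real.pi / 2 := by linarith [Real.pi_gt_three]
  simpa using isBigO_Gamma_comp (S := univ) (M := δ) hδ (by norm_num) hκ
    (fun x _ ↦ by simp [hre x]) fun x _ ↦ him x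

theorem isBigO_Gamma_comp_one_of_re_eq {δ : ℝ} (hδ : 0 < δ) (hre : ∀ x, (g x).re = δ) :
    (fun x ↦ Gamma (g x)) =O[⊤] fun _ ↦ (1 : ℝ) := by
  simpa using isBigO_Gamma_comp_of_re_eq (h := 0) (K := 0) hδ hre fun x ↦ by simp

theorem isBigO_gaussGiventalIntegrand {γ : Fin 3 → ℂ} (x : Fin 3 → ℝ)
    (h₁₂ : -(1 / 2) < (γ 0 - γ 1).im) (h₂₃ : -(1 / 2) < (γ 1 - γ 2).im) :
    gaussGiventalIntegrand γ x =O[⊤] fun s ↦ Real.exp (-(3 / 2 * ‖s‖)) := by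
  rw [sub_im] at h₁₂ h₂₃
  have hexp := isBigO_cexp_one_of_re_le (S := univ) (K := 0) (g := fun s : ℝ × ℝ × ℝ ↦
    I * s.2.1 * (x 0 - x 1) + I * s.1 * (x 0 - x 2) + I * s.2.2 * (x 1 - x 2)) (by simp)
  have h₂₁ := isBigO_Gamma_comp_of_re_eq (g := fun s : ℝ × ℝ × ℝ ↦ 1 / 2 - I * s.2.1)
    (h := fun s ↦ |s.2.1|) (δ := 1 / 2) (K := 0) (by norm_num) (by simp) (by simp)
  have h₁₁ := isBigO_Gamma_comp_of_re_eq (g := fun s : ℝ × ℝ × ℝ ↦ 1 / 2 - I * s.1)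
    (h := fun s ↦ |s.1|) (δ := 1 / 2) (K := 0) (by norm_num) (by simp) (by simp)
  have hsum := isBigO_Gamma_comp_one_of_re_eq
    (g := fun s : ℝ × ℝ × ℝ ↦ 1 - I * s.1 - I * s.2.2) one_pos (by simp)
  have h₁₃ := isBigO_Gamma_comp_one_of_re_eq (δ := (γ 0).im - (γ 2).im + 1)
    (g := fun s : ℝ × ℝ × ℝ ↦ -I * (γ 0 - γ 2 + s.1 + s.2.1) + 1) (by linarith) (by simp)
  have h₂₂ := isBigO_Gamma_comp_of_re_eq (δ := (γ 1).im - (γ 2).im + 1 / 2)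
    (K := |(γ 1 - γ 2).re|) (h := fun s ↦ |s.2.2|)
    (g := fun s : ℝ × ℝ × ℝ ↦ -I * (γ 1 - γ 2 + s.2.2) + 1 / 2) (by linarith) (by simp)
    fun s ↦ by
      have him : (-I * (γ 1 - γ 2 + s.2.2) + 1 / 2).im = -((γ 1 - γ 2).re + s.2.2) := by simp
      rw [him, abs_neg]
      simpa [add_comm] using abs_sub ((γ 1 - γ 2).re + s.2.2) (γ 1 - γ 2).re
  have h₁ := isBigO_Gamma_comp_one_of_re_eq (δ := (γ 0).im - (γ 1).im + 1 / 2)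
    (g := fun s : ℝ × ℝ × ℝ ↦ -I * (γ 0 - γ 1 + s.1) + 1 / 2) (by linarith) (by simp)
  rw [principal_univ] at hexp
  refine ((((((hexp.mul h₂₁).mul h₁₁).mul hsum).mul h₁₃).mul h₂₂).mul h₁).trans ?_
  simp only [one_mul, mul_one, ← Real.exp_add]
  refine principal_univ (α := ℝ × ℝ × ℝ) ▸ isBigO_exp_of_le 0 fun s _ ↦ ?_
  have hnorm : ‖s‖ ≤ |s.1| + (|s.2.1| + |s.2.2|) :=
    (norm_le_norm_fst_add_norm_snd s).trans
      (add_le_add_right (norm_le_norm_fst_add_norm_snd s.2) _)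
  linarith

theorem continuous_gaussGiventalIntegrand {γ : Fin 3 → ℂ} (x : Fin 3 → ℝ)
    (h₁₂ : -(1 / 2) < (γ 0 - γ 1).im) (h₂₃ : -(1 / 2) < (γ 1 - γ 2).im) :
    Continuous (gaussGiventalIntegrand γ x) := by
  rw [sub_im] at h₁₂ h₂₃
  unfold gaussGiventalIntegrand
  refine (((((Continuous.mul (by fun_prop) ?_).mul ?_).mul ?_).mul ?_).mul ?_).mul ?_ <;>
    refine continuous_Gamma_comp (by fun_prop) fun s ↦ ?_ <;> simp <;> linarith

theorem integrable_gaussGiventalIntegrand {γ : Fin 3 → ℂ} (x : Fin 3 → ℝ)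
    (h₁₂ : -(1 / 2) < (γ 0 - γ 1).im) (h₂₃ : -(1 / 2) < (γ 1 - γ 2).im) :
    Integrable (gaussGiventalIntegrand γ x) :=
  integrable_of_isBigO_exp_neg_norm (μ := volume.prod volume)
    (continuous_gaussGiventalIntegrand x h₁₂ h₂₃) (by norm_num)
    (isBigO_gaussGiventalIntegrand x h₁₂ h₂₃)

theorem isBigO_mellinBarnesIntegrand {γ : Fin 3 → ℂ} (x : Fin 3 → ℝ)
    (hγ : ∀ i, (γ i).im < 1 / 2) :
    mellinBarnesIntegrand γ x =O[⊤] fun τ ↦ Real.exp (-(1 / 4 * ‖τ‖)) := by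
  have hκ : Real.pi / 2 < 2 := by linarith [Real.pi_lt_four]
  have hexp := isBigO_cexp_one_of_re_le (S := univ) (K := 0) (g := fun τ : ℝ × ℝ × ℝ ↦
    I * (x 1 - x 2) * (τ.2.1 + τ.2.2) + I * (x 0 - x 1) * τ.1) (by simp)
  have hinv {ℓ : ℝ × ℝ × ℝ → ℝ} := isBigO_inv_Gamma_comp (S := univ) (m := 0) (M := 0) (K := 0)
    (g := fun τ ↦ I * ℓ τ) (h := fun τ ↦ |ℓ τ|) hκ (by simp) (by simp)
  have hdiff {ℓ : ℝ × ℝ × ℝ → ℝ} := isBigO_Gamma_comp_of_re_eq (δ := 1 / 2) (K := 0)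
    (g := fun τ ↦ I * ℓ τ + 1 / 2) (h := fun τ ↦ |ℓ τ|) (by norm_num) (by simp) (by simp)
  have hgamma {ℓ : ℝ × ℝ × ℝ → ℝ} (i : Fin 3) := isBigO_Gamma_comp_of_re_eq
    (δ := 1 / 2 - (γ i).im) (K := |(γ i).re|) (g := fun τ ↦ I * (γ i - ℓ τ) + 1 / 2)
    (h := fun τ ↦ |ℓ τ|) (by linarith [hγ i]) (by simp; ring)
    fun τ ↦ by simpa [add_comm] using abs_sub (γ i).re ((γ i).re - ℓ τ)
  rw [principal_univ] at hexp hinv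
  have hO := ((((hinv (ℓ := fun τ ↦ τ.2.1 - τ.2.2)).mul
    (hinv (ℓ := fun τ ↦ τ.2.2 - τ.2.1))).mul hexp).mul
    (hdiff (ℓ := fun τ ↦ τ.2.1 - τ.1))).mul (hdiff (ℓ := fun τ ↦ τ.2.2 - τ.1))|>.mul
    (IsBigO.finsetProd fun i (_ : i ∈ Finset.univ) ↦
      (hgamma (ℓ := fun τ ↦ τ.2.1) i).mul (hgamma (ℓ := fun τ ↦ τ.2.2) i))
  refine (hO.congr_left fun τ ↦ ?_).trans ?_
  · simp only [mellinBarnesIntegrand, one_div, mul_inv, ofReal_sub, mul_sub]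
  simp only [mul_one, Fin.prod_univ_three, ← Real.exp_add]
  refine principal_univ (α := ℝ × ℝ × ℝ) ▸ isBigO_exp_of_le 0 fun τ _ ↦ ?_
  have hnorm : ‖τ‖ ≤ |τ.1| + (|τ.2.1| + |τ.2.2|) :=
    (norm_le_norm_fst_add_norm_snd τ).trans
      (add_le_add_right (norm_le_norm_fst_add_norm_snd τ.2) _)
  have hfst : |τ.1| ≤ |τ.2.1| + |τ.2.1 - τ.1| := by simpa using abs_sub τ.2.1 (τ.2.1 - τ.1)
  linarith [abs_sub_comm τ.2.1 τ.2.2, abs_sub τ.2.1 τ.2.2, abs_nonneg (τ.2.1 - τ.1),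
    abs_nonneg (τ.2.2 - τ.1), abs_nonneg τ.2.1, abs_nonneg τ.2.2]

theorem continuous_mellinBarnesIntegrand {γ : Fin 3 → ℂ} (x : Fin 3 → ℝ)
    (hγ : ∀ i, (γ i).im < 1 / 2) : Continuous (mellinBarnesIntegrand γ x) := by
  have hinv {ℓ : ℝ × ℝ × ℝ → ℂ} (hℓ : Continuous ℓ) : Continuous fun τ ↦ (Gamma (ℓ τ))⁻¹ :=
    differentiable_one_div_Gamma.continuous.comp (g := fun z ↦ (Gamma z)⁻¹) hℓ
  unfold mellinBarnesIntegrand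
  simp only [one_div, mul_inv]
  refine (((((hinv (by fun_prop)).mul (hinv (by fun_prop))).mul (by fun_prop)).mul
    (continuous_Gamma_comp (by fun_prop) (by simp))).mul
    (continuous_Gamma_comp (by fun_prop) (by simp))).mul (continuous_finsetProd _ fun i _ ↦ ?_)
  refine .mul ?_ ?_ <;> refine continuous_Gamma_comp (by fun_prop) fun s ↦ ?_ <;> simp <;>
    linarith [hγ i]

theorem integrable_mellinBarnesIntegrand {γ : Fin 3 → ℂ} (x : Fin 3 → ℝ)
    (hγ : ∀ i, (γ i).im < 1 / 2) : Integrable (mellinBarnesIntegrand γ x) :=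
  integrable_of_isBigO_exp_neg_norm (μ := volume.prod volume)
    (continuous_mellinBarnesIntegrand x hγ) (by norm_num) (isBigO_mellinBarnesIntegrand x hγ)

end Integrands

section WhittakerKernel

/-- The function of `(t, w)` whose double integral is, up to elementary factors, both integral
representations of the `gl₃(ℝ)`-Whittaker function: here `t` is dual to `x₁ - x₂` and `w` to
`x₂ - x₃`, and `∑ j, γ j - γ i` is the sum of the two parameters other than `γ i`. -/
noncomputable def whittakerKernel (γ : Fin 3 → ℂ) (x : Fin 3 → ℝ) (p : ℂ × ℂ) : ℂ :=
  exp (I * (x 0 - x 1) * p.1 + I * (x 1 - x 2) * p.2) * (∏ i, Gamma (1 + I * (γ i - p.1))) *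
    (∏ i, Gamma (1 + I * (∑ j, γ j - γ i - p.2))) * (Gamma (2 + I * (∑ j, γ j - p.1 - p.2)))⁻¹

variable {γ : Fin 3 → ℂ} (x : Fin 3 → ℝ)

theorem integral_mellinBarnesIntegrand_add_sub (hγ : ∀ i, (γ i).im < 1 / 2) (t w : ℝ) :
    ∫ u : ℝ, mellinBarnesIntegrand γ x (t, w / 2 + u, w / 2 - u) =
      4 * Real.pi * whittakerKernel γ x (t, w) := by
  have ha : 0 < (1 / 2 + I * (w / 2 - t) : ℂ).re := by simp
  have hb (i : Fin 3) : 0 < (1 / 2 + I * (γ i - w / 2)).re := by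
    simp
    linarith [hγ i]
  have hwilson (u : ℝ) : mellinBarnesIntegrand γ x (t, w / 2 + u, w / 2 - u) =
      exp (I * (x 0 - x 1) * t + I * (x 1 - x 2) * w) * (gammaPair (1 / 2 + I * (w / 2 - t)) u *
        wilsonWeight (1 / 2 + I * (γ 0 - w / 2)) (1 / 2 + I * (γ 1 - w / 2))
          (1 / 2 + I * (γ 2 - w / 2)) u) := by
    simp only [mellinBarnesIntegrand, Fin.prod_univ_three, gammaPair, wilsonWeight]
    push_cast
    ring_nf
  simp_rw [hwilson]
  rw [integral_const_mul, ← wilsonIntegral, wilsonIntegral_eq ha (hb 0) (hb 1) (hb 2),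
    wilsonProduct, whittakerKernel]
  simp only [Fin.prod_univ_three, Fin.sum_univ_three]
  ring_nf

theorem exp_mul_integral_gaussGiventalIntegrand_sub (h₁₂ : -(1 / 2) < (γ 0 - γ 1).im)
    (h₂₃ : -(1 / 2) < (γ 1 - γ 2).im) (p q : ℝ) :
    exp (I * (x 0 - x 1) * γ 0 + I * (x 1 - x 2) * (γ 0 + γ 1)) *
      ∫ s : ℝ, gaussGiventalIntegrand γ x (s, p - s, q - s) =
      2 * Real.pi * whittakerKernel γ x (γ 0 + p, γ 0 + γ 1 + q) := by
  rw [sub_im] at h₁₂ h₂₃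
  have ha : 0 < (1 / 2 - I * p : ℂ).re := by simp
  have hb : 0 < (1 / 2 - I * (γ 1 - γ 2 + q)).re := by simp; linarith
  have hc : 0 < (1 / 2 : ℂ).re := by simp
  have hd : 0 < (1 / 2 - I * (γ 0 - γ 1)).re := by simp; linarith
  have hbarnes (s : ℝ) : gaussGiventalIntegrand γ x (s, p - s, q - s) =
      exp (I * (x 0 - x 1) * p + I * (x 1 - x 2) * q) * Gamma (1 - I * q) *
        Gamma (1 + I * (γ 2 - (γ 0 + p))) * (Gamma (1 / 2 - I * p + I * s) *
        Gamma (1 / 2 - I * (γ 1 - γ 2 + q) + I * s) * Gamma (1 / 2 - I * s) *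
        Gamma (1 / 2 - I * (γ 0 - γ 1) - I * s)) := by
    simp only [gaussGiventalIntegrand]
    push_cast
    ring_nf
  have hexp : exp (I * ((x 0 : ℂ) - x 1) * (γ 0 + p) + I * (x 1 - x 2) * (γ 0 + γ 1 + q)) =
      exp (I * (x 0 - x 1) * γ 0 + I * (x 1 - x 2) * (γ 0 + γ 1)) *
        exp (I * (x 0 - x 1) * p + I * (x 1 - x 2) * q) := by
    rw [← exp_add]
    ring_nf
  simp_rw [hbarnes]
  rw [integral_const_mul, integral_barnes_first ha hb hc hd, whittakerKernel, hexp]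
  simp only [Fin.prod_univ_three, Fin.sum_univ_three]
  ring_nf

theorem integral_mellinBarnesIntegrand (hγ : ∀ i, (γ i).im < 1 / 2) :
    ∫ τ, mellinBarnesIntegrand γ x τ =
      4 * Real.pi * ∫ p : ℝ × ℝ, whittakerKernel γ x (p.1, p.2) := by
  have hchange : MeasurePreserving fun p : (ℝ × ℝ) × ℝ ↦
      (p.1.1, p.1.2 / 2 + p.2, p.1.2 / 2 - p.2) :=
    ((MeasurePreserving.id volume).prod measurePreserving_half_add_half_sub).comp
      volume_preserving_prodAssoc
  rw [integral_eq_integral_integral_of_measurePreserving hchange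
    (integrable_mellinBarnesIntegrand x hγ), ← integral_const_mul]
  exact integral_congr_ae (.of_forall fun p ↦
    integral_mellinBarnesIntegrand_add_sub x hγ p.1 p.2)

theorem exp_mul_integral_gaussGiventalIntegrand (h₁₂ : -(1 / 2) < (γ 0 - γ 1).im)
    (h₂₃ : -(1 / 2) < (γ 1 - γ 2).im) :
    exp (I * (x 0 - x 1) * γ 0 + I * (x 1 - x 2) * (γ 0 + γ 1)) *
      ∫ s, gaussGiventalIntegrand γ x s =
      2 * Real.pi * ∫ p : ℝ × ℝ, whittakerKernel γ x (γ 0 + p.1, γ 0 + γ 1 + p.2) := by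
  rw [integral_eq_integral_integral_of_measurePreserving measurePreserving_shear_sub
    (integrable_gaussGiventalIntegrand x h₁₂ h₂₃), ← integral_const_mul, ← integral_const_mul]
  exact integral_congr_ae (.of_forall fun p ↦
    exp_mul_integral_gaussGiventalIntegrand_sub x h₁₂ h₂₃ p.1 p.2)

theorem re_one_add_I_mul_sub (z w : ℂ) : (1 + I * (z - w)).re = 1 - z.im + w.im := by
  simp only [add_re, one_re, mul_re, I_re, I_im, sub_re, sub_im]
  ring

theorem differentiableAt_whittakerKernel {p : ℂ × ℂ} (ht : ∀ i, (γ i).im < 1 + p.1.im)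
    (hw : ∀ i, (∑ j, γ j - γ i).im < 1 + p.2.im) :
    DifferentiableAt ℂ (whittakerKernel γ x) p := by
  have hgamma {g : ℂ × ℂ → ℂ} (hg : DifferentiableAt ℂ g p) (hre : 0 < (g p).re) :
      HasFDerivAt (fun p ↦ Gamma (g p)) (fderiv ℂ (fun p ↦ Gamma (g p)) p) p :=
    ((differentiableAt_Gamma_of_re_pos hre).comp p hg).hasFDerivAt
  unfold whittakerKernel
  refine (DifferentiableAt.mul (by fun_prop) (HasFDerivAt.finsetProd fun i _ ↦
    hgamma (by fun_prop) ?_).differentiableAt).mul (HasFDerivAt.finsetProd fun i _ ↦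
    hgamma (by fun_prop) ?_).differentiableAt |>.mul
    (differentiable_one_div_Gamma.differentiableAt.comp p (g := fun z ↦ (Gamma z)⁻¹) (by fun_prop))
  · linarith [ht i, re_one_add_I_mul_sub (γ i) p.1]
  · linarith [hw i, re_one_add_I_mul_sub (∑ j, γ j - γ i) p.2]

theorem isBigO_Gamma_one_add_I_mul_sub {X : Type*} {S : Set X} {α : ℂ} {ℓ : X → ℂ} {m M : ℝ}
    (hα : α.im < 1 + m) (hℓ : ∀ p ∈ S, (ℓ p).im ∈ Icc m M) :
    (fun p ↦ Gamma (1 + I * (α - ℓ p))) =O[𝓟 S] fun p ↦ Real.exp (-(3 / 2 * |(ℓ p).re|)) := by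
  refine isBigO_Gamma_comp (M := 1 - α.im + M) (δ := 1 - α.im + m) (K := |α.re|) (by linarith)
    (by norm_num) (by linarith [Real.pi_gt_three]) (fun p hp ↦ ?_)
    fun p _ ↦ by simpa [add_comm] using abs_sub α.re (α.re - (ℓ p).re)
  rw [re_one_add_I_mul_sub]
  exact ⟨by linarith [(hℓ p hp).1], by linarith [(hℓ p hp).2]⟩

theorem isBigO_whittakerKernel {a a' b b' : ℝ} (ha : ∀ i, (γ i).im < 1 + a)
    (hb : ∀ i, (∑ j, γ j - γ i).im < 1 + b) :
    whittakerKernel γ x =O[𝓟 ((im ⁻¹' Icc a a') ×ˢ (im ⁻¹' Icc b b'))]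
      fun p ↦ Real.exp (-(1 * (|p.1.re| + |p.2.re|))) := by
  have hκ : Real.pi / 2 < 2 := by linarith [Real.pi_lt_four]
  set S := (im ⁻¹' Icc a a') ×ˢ (im ⁻¹' Icc b b')
  have hexp := isBigO_cexp_one_of_re_le (S := S)
    (g := fun p ↦ I * (x 0 - x 1) * p.1 + I * (x 1 - x 2) * p.2)
    (K := |x 0 - x 1| * max |a| |a'| + |x 1 - x 2| * max |b| |b'|) fun p hp ↦ by
      have hre : (I * (x 0 - x 1) * p.1 + I * (x 1 - x 2) * p.2).re =
          -((x 0 - x 1) * p.1.im) + -((x 1 - x 2) * p.2.im) := by simp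
      rw [hre]
      refine add_le_add ((neg_le_abs _).trans ?_) ((neg_le_abs _).trans ?_) <;> rw [abs_mul]
      · exact mul_le_mul_of_nonneg_left (abs_le_max_abs_abs hp.1.1 hp.1.2) (abs_nonneg _)
      · exact mul_le_mul_of_nonneg_left (abs_le_max_abs_abs hp.2.1 hp.2.2) (abs_nonneg _)
  have hinv := isBigO_inv_Gamma_comp (S := S) (h := fun p ↦ |p.1.re| + |p.2.re|)
    (g := fun p ↦ 2 + I * (∑ j, γ j - p.1 - p.2)) (m := 2 - (∑ j, γ j).im + a + b)
    (M := 2 - (∑ j, γ j).im + a' + b') (K := |(∑ j, γ j).re|) hκ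
    (fun p hp ↦ by
      have hre : (2 + I * (∑ j, γ j - p.1 - p.2)).re = 2 - (∑ j, γ j).im + p.1.im + p.2.im := by
        simp only [add_re, sub_re, mul_re, I_re, I_im, sub_im, re_ofNat]
        ring
      rw [hre]
      exact ⟨by linarith [hp.1.1, hp.2.1], by linarith [hp.1.2, hp.2.2]⟩)
    fun p _ ↦ by
      have him : (2 + I * (∑ j, γ j - p.1 - p.2)).im = (∑ j, γ j).re - p.1.re - p.2.re := by simp
      rw [him]
      linarith [abs_sub ((∑ j, γ j).re - p.1.re) p.2.re, abs_sub (∑ j, γ j).re p.1.re]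
  have hgamma_t := IsBigO.finsetProd fun i (_ : i ∈ Finset.univ) ↦
    isBigO_Gamma_one_add_I_mul_sub (S := S) (ℓ := Prod.fst) (ha i) fun p hp ↦ hp.1
  have hgamma_w := IsBigO.finsetProd fun i (_ : i ∈ Finset.univ) ↦
    isBigO_Gamma_one_add_I_mul_sub (S := S) (ℓ := Prod.snd) (hb i) fun p hp ↦ hp.2
  refine (((hexp.mul hgamma_t).mul hgamma_w).mul hinv).trans ?_
  simp only [one_mul, Fin.prod_univ_three, ← Real.exp_add]
  exact isBigO_exp_of_le 0 fun p _ ↦ by linarith [abs_nonneg p.1.re, abs_nonneg p.2.re]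

theorem integral_whittakerKernel_add {α β : ℂ} (h₁ : ∀ i, (γ i).im < 1)
    (hα : ∀ i, (γ i).im < 1 + α.im) (h₂ : ∀ i, (∑ j, γ j - γ i).im < 1)
    (hβ : ∀ i, (∑ j, γ j - γ i).im < 1 + β.im) :
    ∫ p : ℝ × ℝ, whittakerKernel γ x (α + p.1, β + p.2) =
      ∫ p : ℝ × ℝ, whittakerKernel γ x (p.1, p.2) := by
  have hmin {y z : ℝ} (h : y < 1) (h' : y < 1 + z) : y < 1 + min 0 z := by
    rw [← min_add_add_left, add_zero]
    exact lt_min h h'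
  have ht (i : Fin 3) := hmin (h₁ i) (hα i)
  have hw (i : Fin 3) := hmin (h₂ i) (hβ i)
  exact integral_prod_add_eq_of_isBigO_exp_neg one_pos
    (fun p hp ↦ differentiableAt_whittakerKernel x
      (fun i ↦ (ht i).trans_le (by linarith [hp.1.1]))
      fun i ↦ (hw i).trans_le (by linarith [hp.2.1]))
    (isBigO_whittakerKernel x ht hw)

theorem integral_whittakerKernel_gaussGivental_contour (hγ : ∀ i, (γ i).im < 1 / 2)
    (h₁₂ : -(1 / 2) < (γ 0 - γ 1).im) (h₂₃ : -(1 / 2) < (γ 1 - γ 2).im) :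
    ∫ p : ℝ × ℝ, whittakerKernel γ x (γ 0 + p.1, γ 0 + γ 1 + p.2) =
      ∫ p : ℝ × ℝ, whittakerKernel γ x (p.1, p.2) := by
  have h₀ := hγ 0
  have h₁ := hγ 1
  have h₂ := hγ 2
  rw [sub_im] at h₁₂ h₂₃
  have hsum : (∑ j, γ j).im = (γ 0).im + (γ 1).im + (γ 2).im := by
    simp only [Fin.sum_univ_three, add_im]
  refine integral_whittakerKernel_add x ?_ ?_ ?_ ?_ <;> intro i <;> fin_cases i <;>
    simp only [Fin.zero_eta, Fin.mk_one, Fin.reduceFinMk, sub_im, add_im, hsum] <;> linarith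

end WhittakerKernel

end

theorem mainTheorem3 (γ : Fin 3 → ℂ) (x : Fin 3 → ℝ)
    (hγ : ∀ i, (γ i).im < 1 / 2)
    (h₁₂ : -(1 / 2) < (γ 0 - γ 1).im) (h₂₃ : -(1 / 2) < (γ 1 - γ 2).im) :
    Integrable (gaussGiventalIntegrand γ x) ∧
    Integrable (mellinBarnesIntegrand γ x) ∧
    gaussGiventalIntegral γ x = 1 / 2 * mellinBarnesIntegral γ x := by
  refine ⟨integrable_gaussGiventalIntegrand x h₁₂ h₂₃, integrable_mellinBarnesIntegrand x hγ, ?_⟩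
  have hgg := exp_mul_integral_gaussGiventalIntegrand x h₁₂ h₂₃
  have hprefactor : I * (γ 0 * x 0 + γ 1 * x 1 + γ 2 * x 2) - x 0 + x 2 =
      (I * (γ 0 + γ 1 + γ 2) * x 2 - (x 0 - x 2)) +
        (I * (x 0 - x 1) * γ 0 + I * (x 1 - x 2) * (γ 0 + γ 1)) := by ring
  rw [gaussGiventalIntegral, mellinBarnesIntegral, integral_mellinBarnesIntegrand x hγ, hprefactor,
    exp_add, mul_div_right_comm, mul_assoc, hgg,
    integral_whittakerKernel_gaussGivental_contour x hγ h₁₂ h₂₃]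
  ring
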